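/- Let $g\ge 0$ be an integer and let $\mathbf C=(c_1,\dots,c_g)$ be an ordered collection of distinct real points. For $\vec p,\vec q\in\mathbb R^{g+1}$, with coordinates indexed by $0,\dots,g$, put $$A(\vec p)=\delta_g\vec p^{\,*},\qquad B(\vec p,\vec q)=(\vec q\,\vec p^{\,*})^-+(\vec p\,\vec q^{\,*})^++\operatorname{diag}(c_1,\dots,c_g,0),$$ where $\delta_g$ is the last standard basis vector, $T^-$ is the part of a matrix $T$ strictly above the diagonal and $T^+=T-T^-$. A matrix indexed by $\mathbb Z\times\mathbb Z$, split into blocks of size $g+1$ (block $0$ starting at index $0$), is of the class $\mathbb A$ with points $\mathbf C$ and generating coefficients $(\vec p_j,\vec q_j)_{j\in\mathbb Z}$ if it is block tridiagonal, its $j$-th block row is $A(\vec p_j)^*,\ B(\vec p_j,\vec q_j),\ A(\vec p_{j+1})$ around the diagonal, and the last entry of every $\vec p_j$ is positive. Let $S$ be the shift $Se_n=e_{n+1}$ on $\ell^2(\mathbb Z)$. A bounded operator $A$ on $\ell^2(\mathbb Z)$ is a GMP matrix, $A\in\mathrm{GMP}(\mathbf C)$, if it is of the class $\mathbb A$ with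 points $\mathbf C$ and, for every $1\le k\le g$, the operator $c_k-A$ is invertible and $S^{-k}(c_k-A)^{-1}S^k$ is again of the class $\mathbb A$ (with suitable points in place of $\mathbf C$). It is periodic with coefficients $\vec p=(p_0,\dots,p_g)$, $\vec q=(q_0,\dots,q_g)$ if $(\vec p_j,\vec q_j)=(\vec p,\vec q)$ for all $j\in\mathbb Z$. Let $A\in\mathrm{GMP}(\mathbf C)$ be periodic with coefficients $\vec p,\vec q$. Put $\mathfrak j=\begin{bmatrix}0&-1\\1&0\end{bmatrix}$, $$\mathfrak a(z;p,q)=\begin{bmatrix}0&-p\\ \frac1p&\frac{z-pq}{p}\end{bmatrix},\qquad \mathfrak a(z,c;p,q)=I-\frac1{c-z}\begin{bmatrix}p\\q\end{bmatrix}\begin{bmatrix}p&q\end{bmatrix}\mathfrak j,$$ and let $$\mathfrak A(z)=\mathfrak a(z,c_1;p_0,q_0)\,\mathfrak a(z,c_2;p_1,q_1)\cdots\mathfrak a(z,c_g;p_{g-1},q_{g-1})\,\mathfrak a(z;p_g,q_g),\qquad \Delta^A(z)=\operatorname{tr}\mathfrak A(z),$$ for $z\in\mathbb C\setminus\{c_1,\dots,c_g\}$.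 Then $A$ is self-adjoint and has purely absolutely continuous spectrum (the spectral measure of $A$ at every vector of $\ell^2(\mathbb Z)$ is absolutely continuous with respect to Lebesgue measure), and $$\sigma(A)=\sigma_{ac}(A)=\big\{z\in\mathbb C\setminus\{c_1,\dots,c_g\}\colon \Delta^A(z)\in[-2,2]\big\}.$$ -/

import Mathlib

open scoped InnerProductSpace CompactlySupported ComplexOrder
open MeasureTheory

noncomputable section

namespace GMP

/-! ### Spectral measures and absolutely continuous spectrum of bounded self-adjoint operators -/

section Spectral

variable {H : Type*} [NormedAddCommGroup H] [InnerProductSpace ℂ H] [CompleteSpace H]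

/-- The positive functional `h ↦ ⟨f, h(A) f⟩` on compactly supported continuous functions `h`, where
`h(A)` is given by the continuous functional calculus of the self-adjoint operator `A`. -/
def spectralFunctional (A : H →L[ℂ] H) (f : H) : C_c(ℝ, ℝ) →ₚ[ℝ] ℝ :=
  PositiveLinearMap.mk₀
    { toFun := fun h => RCLike.re ⟪f, cfc (h : ℝ → ℝ) A f⟫_ℂ
      map_add' := fun h k => by
        have : cfc ((h + k : C_c(ℝ, ℝ)) : ℝ → ℝ) A = cfc (h : ℝ → ℝ) A + cfc (k : ℝ → ℝ) A :=
          cfc_add A h k h.continuous.continuousOn k.continuous.continuousOn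
        rw [this]
        simp
      map_smul' := fun c h => by
        have : cfc ((c • h : C_c(ℝ, ℝ)) : ℝ → ℝ) A = c • cfc (h : ℝ → ℝ) A :=
          cfc_smul c h A h.continuous.continuousOn
        rw [this]
        simp [inner_smul_right_eq_smul] }
    (fun h hh => by
      have h0 : 0 ≤ cfc (h : ℝ → ℝ) A := cfc_nonneg fun x _ => hh x
      exact (ContinuousLinearMap.nonneg_iff_isPositive _).1 h0 |>.re_inner_nonneg_right f)

/-- The spectral measure of the self-adjoint operator `A` at the vector `f`: the measure that
represents the functional `h ↦ ⟨f, h(A) f⟩` (Riesz–Markov–Kakutani). -/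
def spectralMeasure (A : H →L[ℂ] H) (f : H) : Measure ℝ :=
  RealRMK.rieszMeasure (spectralFunctional A f)

theorem integral_spectralMeasure (A : H →L[ℂ] H) (f : H) (h : C_c(ℝ, ℝ)) :
    ∫ x, h x ∂(spectralMeasure A f) = RCLike.re ⟪f, cfc (h : ℝ → ℝ) A f⟫_ℂ :=
  RealRMK.integral_rieszMeasure (spectralFunctional A f) h

/-- The absolutely continuous subspace `H_ac` of a self-adjoint operator: the vectors whose spectral
measure is absolutely continuous with respect to Lebesgue measure. -/
def acVectors (A : H →L[ℂ] H) : Set H := {f | spectralMeasure A f ≪ volume}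

/-- The absolutely continuous spectrum of a self-adjoint operator `A`, that is, the spectrum of the
restriction of `A` to its closed reducing subspace `H_ac`: a number `z` is in the resolvent set of
the restriction iff `A - z` maps `H_ac` bijectively onto `H_ac` (the inverse is then automatically
bounded). -/
def acSpectrum (A : H →L[ℂ] H) : Set ℂ :=
  {z | ¬ Set.BijOn (fun f : H => A f - z • f) (acVectors A) (acVectors A)}

/-- `A` is self-adjoint and has purely absolutely continuous spectrum: every spectral measure of `A`
is absolutely continuous, i.e. `H_ac` is the whole space. -/
def HasPurelyACSpectrum (A : H →L[ℂ] H) : Prop :=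
  IsSelfAdjoint A ∧ ∀ f : H, spectralMeasure A f ≪ volume

end Spectral

/-! ### GMP matrices -/

/-- The Hilbert space `ℓ²(ℤ)` of complex two-sided square summable sequences. -/
abbrev EllTwo : Type := lp (fun _ : ℤ => ℂ) 2

/-- The standard basis vector `e_n`. -/
def e (n : ℤ) : EllTwo := lp.single 2 n 1

/-- The matrix of a bounded operator on `ℓ²(ℤ)` in the standard basis; the entry at `(m, n)` is
`⟨T e_n, e_m⟩` (linear in the first argument). -/
def matrixOf (T : EllTwo →L[ℂ] EllTwo) : Matrix ℤ ℤ ℂ := Matrix.of fun m n => (T (e n) : ℤ → ℂ) m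

/-- The matrix of `S^{-k} T S^k`, where `T` has matrix `M` and `S e_n = e_{n+1}`. -/
def shiftConj (k : ℤ) (M : Matrix ℤ ℤ ℂ) : Matrix ℤ ℤ ℂ := M.submatrix (· + k) (· + k)

/-- The `(j, k)` block of size `g + 1` of a two-sided matrix; block `0` starts at index `0`. -/
def block (g : ℕ) (M : Matrix ℤ ℤ ℂ) (j k : ℤ) : Matrix (Fin (g + 1)) (Fin (g + 1)) ℂ :=
  Matrix.of fun l m => M (j * (g + 1) + (l : ℕ)) (k * (g + 1) + (m : ℕ))

/-- The off-diagonal block `A(p) = δ_g p*`. -/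
def offDiagBlock {g : ℕ} (p : Fin (g + 1) → ℝ) : Matrix (Fin (g + 1)) (Fin (g + 1)) ℝ :=
  Matrix.vecMulVec (Pi.single (Fin.last g) 1) p

/-- The diagonal block `B(p, q) = (q p*)⁻ + (p q*)⁺ + diag(c_1, …, c_g, 0)`, where `T⁻` is the part
of `T` strictly above the diagonal and `T⁺ = T - T⁻`. -/
def diagBlock {g : ℕ} (C : Fin g → ℝ) (p q : Fin (g + 1) → ℝ) :
    Matrix (Fin (g + 1)) (Fin (g + 1)) ℝ :=
  Matrix.of (fun l m => if l < m then Matrix.vecMulVec q p l m else Matrix.vecMulVec p q l m)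
    + Matrix.diagonal (Fin.snoc C 0 : Fin (g + 1) → ℝ)

/-- The two-sided matrix `M` is the `(g + 1)`-block Jacobi matrix of the class `𝔸` with points `C`
and generating coefficient sequences `(P j, Q j)`, `j ∈ ℤ`: its `j`-th block row is
`A(P j)*, B(P j, Q j), A(P (j + 1))` around the diagonal, and the last entry of each `P j`
is positive. -/
structure IsClassAWith {g : ℕ} (C : Fin g → ℝ) (P Q : ℤ → Fin (g + 1) → ℝ)
    (M : Matrix ℤ ℤ ℂ) : Prop where
  last_pos : ∀ j, 0 < P j (Fin.last g)
  diag : ∀ j, block g M j j = (diagBlock C (P j) (Q j)).map Complex.ofReal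
  upper : ∀ j, block g M j (j + 1) = (offDiagBlock (P (j + 1))).map Complex.ofReal
  lower : ∀ j, block g M j (j - 1) = ((offDiagBlock (P j)).transpose).map Complex.ofReal
  far : ∀ j k, 1 < |j - k| → block g M j k = 0

/-- The two-sided matrix `M` is of the class `𝔸` with points `C`. -/
def IsClassA {g : ℕ} (C : Fin g → ℝ) (M : Matrix ℤ ℤ ℂ) : Prop :=
  ∃ P Q : ℤ → Fin (g + 1) → ℝ, IsClassAWith C P Q M

/-- `A` is a GMP matrix for the ordered points `C = (c_1, …, c_g)`: its matrix is of the class `𝔸`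
with points `C`, each `c_k - A` is invertible, and `S^{-k} (c_k - A)⁻¹ S^k` is again of the
class `𝔸`, for suitable points `D` (the point `c_k` is `C k` with the index `k` counted from `0`,
whence the shift by `k + 1`). -/
structure IsGMP {g : ℕ} (C : Fin g → ℝ) (A : EllTwo →L[ℂ] EllTwo) : Prop where
  classA : IsClassA C (matrixOf A)
  isUnit : ∀ k : Fin g, IsUnit (algebraMap ℂ (EllTwo →L[ℂ] EllTwo) (C k) - A)
  inverse_classA : ∀ k : Fin g, ∃ D : Fin g → ℝ,
    IsClassA D (shiftConj ((k : ℕ) + 1)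
      (matrixOf (Ring.inverse (algebraMap ℂ (EllTwo →L[ℂ] EllTwo) (C k) - A))))

/-- `A` is one-block periodic with coefficients `p` and `q`: all blocks of `A` have the same
generating coefficients `(p, q)`. -/
def IsPeriodicWith {g : ℕ} (C : Fin g → ℝ) (p q : Fin (g + 1) → ℝ)
    (A : EllTwo →L[ℂ] EllTwo) : Prop :=
  IsClassAWith C (fun _ => p) (fun _ => q) (matrixOf A)

/-! ### The transfer matrix -/

/-- The matrix `𝔞(z, ∞; p, q)`. -/
def transferInfty (z : ℂ) (p q : ℝ) : Matrix (Fin 2) (Fin 2) ℂ :=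
  !![0, -(p : ℂ); 1 / (p : ℂ), (z - p * q) / p]

/-- The matrix `𝔧`. -/
def jMatrix : Matrix (Fin 2) (Fin 2) ℂ := !![0, -1; 1, 0]

/-- The matrix `𝔞(z, c; p, q) = I - (c - z)⁻¹ (p, q)ᵀ (p, q) 𝔧`. -/
def transferPoint (z : ℂ) (c p q : ℝ) : Matrix (Fin 2) (Fin 2) ℂ :=
  1 - (1 / ((c : ℂ) - z)) • (Matrix.vecMulVec ![(p : ℂ), (q : ℂ)] ![(p : ℂ), (q : ℂ)] * jMatrix)

/-- The transfer matrix `𝔄(z) = 𝔞(z, c_1; p_0, q_0) ⋯ 𝔞(z, c_g; p_{g-1}, q_{g-1}) 𝔞(z, ∞; p_g, q_g)`,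
a rational function of `z`, regular outside `{c_1, …, c_g}`. -/
def transferMatrix {g : ℕ} (C : Fin g → ℝ) (p q : Fin (g + 1) → ℝ) (z : ℂ) :
    Matrix (Fin 2) (Fin 2) ℂ :=
  (List.ofFn fun k : Fin g => transferPoint z (C k) (p k.castSucc) (q k.castSucc)).prod *
    transferInfty z (p (Fin.last g)) (q (Fin.last g))

/-- The discriminant `Δ(z) = tr 𝔄(z)`. -/
def discriminant {g : ℕ} (C : Fin g → ℝ) (p q : Fin (g + 1) → ℝ) (z : ℂ) : ℂ :=
  (transferMatrix C p q z).trace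

end GMP

end

/-!
Write `T = S^{g+1}` for the translation by one block, which commutes with the periodic operator `A`.
The proof rests on the identity `Δ(A) = T + T⁻¹`, and on the fact that `T + T⁻¹` has spectrum in
`[-2, 2]` and arcsine distributions as spectral measures at the basis vectors.

For the identity, `ℓ²(ℤ)` is a module over the commutative ring `R` of continuous functions on the
spectrum of `A`, acting through the functional calculus, and `T` is `R`-linear. The formula for
`A e_m` says that the vectors `e_0, …, e_g` of one block solve the eigenvalue equation of the
periodic matrix with spectral parameter the identity function `z ∈ R` and with Bloch multiplier `T`
(`IsBlochSolution`). The partial sums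
`α_m = T⁻¹ e_g + ∑_{l < m} q_l e_l` and `β_m = ∑_{l ≥ m} p_l e_l` satisfy
`(z - c_m) e_m = p_m α_m + q_m β_m` for `m < g` (points indexed from `0`), whence
`(α_{m+1}, β_{m+1})` is the image of `(α_m, β_m)` under the transposed transfer matrix of the point
`c_m`; here `c_m - z` is invertible in `R` because `c_m - A` is invertible.
After one period the transposed `𝔄(z)` acts on `(α_0, β_0)` as `T`. Since
`det 𝔄 = 1`, the Cayley–Hamilton theorem gives `T + T⁻¹ = Δ(z)` on `α_0` and `β_0`, hence on all
`e_m` (`add_symm_eq_trace_smul_of_isBlochSolution`, `IsPeriodicOperator.cfc_realDiscriminant`).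

Spectral mapping and `‖T + T⁻¹‖ ≤ 2` show that `Δ` maps the spectrum of `A` into `[-2, 2]`.
Conversely, if `Δ(z) = w + w⁻¹` with `|w| = 1`, the same recursion run from an eigenvector of the
transposed `𝔄(z)` produces a nonzero scalar Bloch solution `v`, and then
`(A - z) ∑ v_m e_m = (T - w⁻¹) y` for some `y`. If `A - z` were invertible, `∑ v_m e_m` would lie in
the range of `T - w⁻¹`, which contains no nonzero vector of finite support inside one block
(`exists_scalar_isBlochSolution`, `eq_zero_of_blockShift_sub`, `mem_spectrum_of_discriminant`).

For the absolute continuity, let `K` be a compact null subset of the spectrum. As `Δ` is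
differentiable away from the points `c_k`, the set `Δ(K)` is null. Cutoff functions `h_n` shrinking
to `Δ(K)` satisfy `h_n(T + T⁻¹) → 0` strongly: this is checked on basis vectors, where the moments
are computed with Chebyshev polynomials and give the arcsine distribution
(`re_inner_cfc_basis`, `tendsto_cfc_thickenedIndicator`). Since `h_n(Δ(A)) = h_n(T + T⁻¹)` and
`h_n ∘ Δ = 1` on `K`, every spectral measure of `A` vanishes on `K`
(`IsPeriodicOperator.spectralMeasure_eq_zero`), and regularity of the spectral measures extends this
to all null sets. All vectors being absolutely continuous, the absolutely continuous spectrum is the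
spectrum.
-/

noncomputable section

namespace GMP

/-! ### Transfer matrices over a commutative ring -/

section Transfer

open Matrix Matrix.Module

variable {K : Type*} [CommRing K] {V : Type*} [AddCommGroup V] [Module K V] {g : ℕ}

/-- The elementary transfer matrix `𝔞(z, c; p, q)` over a commutative ring; `u` stands for
`(c - z)⁻¹`. -/
def transferFactor (u p q : K) : Matrix (Fin 2) (Fin 2) K :=
  !![1 - u * (p * q), u * (p * p); -(u * (q * q)), 1 + u * (q * p)]

/-- The elementary transfer matrix `𝔞(z, ∞; p, q)` over a commutative ring; `r` stands for
`p⁻¹`. -/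
def transferLast (z p q r : K) : Matrix (Fin 2) (Fin 2) K :=
  !![0, -p; r, (z - p * q) * r]

/-- The ordered list of the factors `𝔞(z, c_k; p_{k-1}, q_{k-1})`. -/
def transferList (u : Fin g → K) (p q : Fin (g + 1) → K) : List (Matrix (Fin 2) (Fin 2) K) :=
  List.ofFn fun k : Fin g => transferFactor (u k) (p k.castSucc) (q k.castSucc)

/-- The transfer matrix `𝔄(z)` over a commutative ring, with `u k` in the role of `(c_k - z)⁻¹` and
`r` in the role of `p_g⁻¹`. -/
def monodromy (z : K) (u : Fin g → K) (p q : Fin (g + 1) → K) (r : K) :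
    Matrix (Fin 2) (Fin 2) K :=
  (transferList u p q).prod * transferLast z (p (Fin.last g)) (q (Fin.last g)) r

/-- The family `v` of vectors solves the eigenvalue equation of the periodic block matrix:
`z` is the spectral parameter, `τ` the translation by one block, and `c` lists the points of the
class `𝔸` followed by `0`. -/
def IsBlochSolution (z : K) (c p q : Fin (g + 1) → K) (τ : V ≃ₗ[K] V) (v : Fin (g + 1) → V) :
    Prop :=
  ∀ m, (z - c m) • v m = p m • τ.symm (v (Fin.last g))
    + ∑ l, (if l < m then q l * p m else p l * q m) • v l
    + if m = Fin.last g then τ (∑ l, p l • v l) else 0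

theorem det_transferFactor (u p q : K) : (transferFactor u p q).det = 1 := by
  simp only [transferFactor, det_fin_two_of]; ring

theorem det_monodromy (z : K) (u : Fin g → K) (p q : Fin (g + 1) → K) (r : K)
    (hr : p (Fin.last g) * r = 1) : (monodromy z u p q r).det = 1 := by
  have h1 : (transferList u p q).prod.det = 1 := by
    rw [← coe_detMonoidHom, map_list_prod]
    refine List.prod_eq_one fun x hx => ?_
    simp only [transferList, List.map_ofFn, List.mem_ofFn, Function.comp] at hx
    obtain ⟨k, rfl⟩ := hx
    exact det_transferFactor _ _ _
  rw [monodromy, det_mul, h1, transferLast, det_fin_two_of]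
  linear_combination hr

theorem map_monodromy {L : Type*} [CommRing L] (f : K →+* L) (z : K) (u : Fin g → K)
    (p q : Fin (g + 1) → K) (r : K) :
    (monodromy z u p q r).map f
      = monodromy (f z) (fun k => f (u k)) (fun k => f (p k)) (fun k => f (q k)) (f r) := by
  have h (M : Matrix (Fin 2) (Fin 2) K) : M.map f = f.mapMatrix M := rfl
  rw [h, monodromy, monodromy, map_mul, map_list_prod]
  congr 1
  · simp only [transferList, List.map_ofFn]
    congr 2
    funext k
    ext i j
    fin_cases i <;> fin_cases j <;> simp [transferFactor]
  · ext i j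
    fin_cases i <;> fin_cases j <;> simp [transferLast]

theorem map_trace_monodromy {L : Type*} [CommRing L] (f : K →+* L) (z : K) (u : Fin g → K)
    (p q : Fin (g + 1) → K) (r : K) :
    f (monodromy z u p q r).trace
      = (monodromy (f z) (fun k => f (u k)) (fun k => f (p k)) (fun k => f (q k)) (f r)).trace := by
  rw [← map_monodromy, trace, map_sum]; rfl

/-- The discriminant is the trace of the transfer matrix with `(c_k - z)⁻¹` and `p_g⁻¹` inserted. -/
theorem discriminant_eq_trace_monodromy (C : Fin g → ℝ) (p q : Fin (g + 1) → ℝ) (z : ℂ) :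
    discriminant C p q z = (monodromy z (fun k => ((C k : ℂ) - z)⁻¹) (fun k => (p k : ℂ))
      (fun k => (q k : ℂ)) ((p (Fin.last g) : ℂ)⁻¹)).trace := by
  rw [discriminant, transferMatrix, monodromy, transferList]
  congr 4
  · funext k
    ext i j
    fin_cases i <;> fin_cases j <;>
      simp [transferFactor, transferPoint, jMatrix, vecMulVec, Matrix.mul_apply, Fin.sum_univ_two]
  · ext i j
    fin_cases i <;> fin_cases j <;> simp [transferLast, transferInfty, div_eq_mul_inv]

/-- Cayley–Hamilton for a `2 × 2` matrix acting on pairs of vectors. -/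
theorem smul_smul_fin_two (M : Matrix (Fin 2) (Fin 2) K) (x : Fin 2 → V) :
    M • M • x = M.trace • M • x - M.det • x := by
  funext i
  simp only [Module.smul_apply, Pi.sub_apply, Pi.smul_apply, Fin.sum_univ_two, trace_fin_two,
    det_fin_two]
  fin_cases i <;> simp <;> module

/-- A linear map acting entrywise commutes with the action of matrices. -/
theorem map_matrix_smul (L : V →ₗ[K] V) (M : Matrix (Fin 2) (Fin 2) K) (x : Fin 2 → V) (i : Fin 2) :
    L ((M • x) i) = (M • (fun j => L (x j))) i := by
  simp

/-- The state after `n` steps of the transfer recursion started at `x`. -/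
def transferState (u : Fin g → K) (p q : Fin (g + 1) → K) (x : Fin 2 → V) (n : ℕ) : Fin 2 → V :=
  ((transferList u p q).take n).prodᵀ • x

theorem transferState_zero (u : Fin g → K) (p q : Fin (g + 1) → K) (x : Fin 2 → V) :
    transferState u p q x 0 = x := by
  simp [transferState]

theorem transferState_succ (u : Fin g → K) (p q : Fin (g + 1) → K) (x : Fin 2 → V) (k : Fin g) :
    transferState u p q x (k + 1)
      = (transferFactor (u k) (p k.castSucc) (q k.castSucc))ᵀ • transferState u p q x k := by
  have hk : (k : ℕ) < (transferList u p q).length := by simp [transferList]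
  rw [transferState, List.prod_take_succ _ _ hk, transpose_mul, mul_smul]
  simp [transferState, transferList]

theorem monodromy_transpose_smul (z : K) (u : Fin g → K) (p q : Fin (g + 1) → K) (r : K)
    (x : Fin 2 → V) :
    (monodromy z u p q r)ᵀ • x = (transferLast z (p (Fin.last g)) (q (Fin.last g)) r)ᵀ •
      transferState u p q x g := by
  have : (transferList u p q).take g = transferList u p q :=
    List.take_of_length_le (by simp [transferList])
  rw [monodromy, transpose_mul, mul_smul, transferState, this]

/-- In terms of the partial sums, a transfer step adds `q v` to the first entry and `-p v` to the
second one, where `(z - c) v` is the combination of the two entries with coefficients `p`, `q`. -/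
theorem transferFactor_transpose_smul (u p q : K) (x : Fin 2 → V) :
    (transferFactor u p q)ᵀ • x
      = ![x 0 + q • (-u) • (p • x 0 + q • x 1), x 1 - p • (-u) • (p • x 0 + q • x 1)] := by
  funext i
  fin_cases i <;> simp [transferFactor] <;> module

theorem transferLast_transpose_smul (z p q r : K) (x : Fin 2 → V) :
    (transferLast z p q r)ᵀ • x = ![r • x 1, -(p • x 0) + ((z - p * q) * r) • x 1] := by
  funext i
  fin_cases i <;> simp [transferLast]

/-- The sum of `a l • v l` over the indices `l` smaller than `n`. -/
def partialSum (a : Fin (g + 1) → K) (v : Fin (g + 1) → V) (n : ℕ) : V :=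
  ∑ l : Fin (g + 1), if (l : ℕ) < n then a l • v l else 0

theorem partialSum_zero (a : Fin (g + 1) → K) (v : Fin (g + 1) → V) : partialSum a v 0 = 0 := by
  simp [partialSum]

theorem partialSum_succ (a : Fin (g + 1) → K) (v : Fin (g + 1) → V) (m : Fin (g + 1)) :
    partialSum a v (m + 1) = partialSum a v m + a m • v m := by
  have : a m • v m = ∑ l, if l = m then a l • v l else 0 := by simp
  rw [this, partialSum, partialSum, ← Finset.sum_add_distrib]
  refine Finset.sum_congr rfl fun l _ => ?_
  rcases lt_trichotomy l m with h | h | h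
  · simp [h.ne, Nat.lt_succ_of_lt h, show (l : ℕ) < m from h]
  · simp [h]
  · simp [h.ne', show ¬ (l : ℕ) < m + 1 by have : (m : ℕ) < l := h; omega,
      show ¬ (l : ℕ) < m by have : (m : ℕ) < l := h; omega]

theorem partialSum_full (a : Fin (g + 1) → K) (v : Fin (g + 1) → V) :
    partialSum a v (g + 1) = ∑ l, a l • v l := by
  simp [partialSum, Fin.is_le]

/-- The triangular structure of the diagonal block: the part below the index `m` and the rest are
partial sums with coefficients `q` and `p` respectively. -/
theorem sum_triangular_smul (p q : Fin (g + 1) → K) (v : Fin (g + 1) → V) (m : Fin (g + 1)) :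
    ∑ l, (if l < m then q l * p m else p l * q m) • v l
      = p m • partialSum q v m + q m • (∑ l, p l • v l - partialSum p v m) := by
  rw [partialSum, partialSum, ← Finset.sum_sub_distrib, Finset.smul_sum, Finset.smul_sum,
    ← Finset.sum_add_distrib]
  refine Finset.sum_congr rfl fun l _ => ?_
  by_cases h : l < m
  · simp only [h, if_true, show (l : ℕ) < m from h]; module
  · simp only [h, if_false, show ¬ (l : ℕ) < m from h]; module

/-- The Bloch equation in terms of the two states of the transfer recursion. -/
theorem isBlochSolution_iff (z : K) (c p q : Fin (g + 1) → K) (τ : V ≃ₗ[K] V)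
    (v : Fin (g + 1) → V) :
    IsBlochSolution z c p q τ v ↔ ∀ m, (z - c m) • v m =
      p m • (τ.symm (v (Fin.last g)) + partialSum q v m)
        + q m • (∑ l, p l • v l - partialSum p v m)
        + if m = Fin.last g then τ (∑ l, p l • v l) else 0 := by
  refine forall_congr' fun m => ?_
  rw [sum_triangular_smul, smul_add]
  simp only [add_assoc]

variable {z : K} {C : Fin g → K} {u : Fin g → K} {p q : Fin (g + 1) → K} {r : K}
  {τ : V ≃ₗ[K] V}

/-- The vectors of a Bloch solution are recovered from the states of the transfer recursion whose
initial state is `(τ⁻¹ v_g, ∑ p_l v_l)`. -/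
theorem transferState_of_isBlochSolution {v : Fin (g + 1) → V}
    (hu : ∀ k, u k * (C k - z) = 1)
    (hv : IsBlochSolution z (Fin.snoc C 0 : Fin (g + 1) → K) p q τ v) {n : ℕ} (hn : n ≤ g) :
    transferState u p q ![τ.symm (v (Fin.last g)), ∑ l, p l • v l] n
      = ![τ.symm (v (Fin.last g)) + partialSum q v n, ∑ l, p l • v l - partialSum p v n] := by
  induction n with
  | zero => simp [transferState_zero, partialSum_zero]
  | succ n ih =>
    have h := transferState_succ u p q ![τ.symm (v (Fin.last g)), ∑ l, p l • v l] ⟨n, hn⟩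
    simp only at h
    have hb := (isBlochSolution_iff _ _ _ _ _ _).1 hv (Fin.castSucc ⟨n, hn⟩)
    rw [if_neg (Fin.castSucc_lt_last _).ne, add_zero, Fin.snoc_castSucc] at hb
    have hw : v (Fin.castSucc ⟨n, hn⟩)
        = (-u ⟨n, hn⟩) • ((z - C ⟨n, hn⟩) • v (Fin.castSucc ⟨n, hn⟩)) := by
      rw [smul_smul, show -u ⟨n, hn⟩ * (z - C ⟨n, hn⟩) = 1 by linear_combination hu ⟨n, hn⟩,
        one_smul]
    have hq := partialSum_succ q v (Fin.castSucc ⟨n, hn⟩)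
    have hp := partialSum_succ p v (Fin.castSucc ⟨n, hn⟩)
    rw [hb] at hw
    simp only [Fin.val_castSucc] at hq hp hw
    rw [h, ih (by omega), transferFactor_transpose_smul, hq, hp]
    simp only [Matrix.cons_val_zero, Matrix.cons_val_one, ← hw, add_assoc, sub_sub]

/-- A Bloch solution is annihilated by `τ + τ⁻¹ - Δ(z)`: one period of the transfer recursion acts
on the initial state both as the transfer matrix and as `τ`, and the transfer matrix has
determinant one. -/
theorem add_symm_eq_trace_smul_of_isBlochSolution {v : Fin (g + 1) → V}
    (hu : ∀ k, u k * (C k - z) = 1) (hr : p (Fin.last g) * r = 1)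
    (hv : IsBlochSolution z (Fin.snoc C 0 : Fin (g + 1) → K) p q τ v) (m : Fin (g + 1)) :
    τ (v m) + τ.symm (v m) = (monodromy z u p q r).trace • v m := by
  set x : Fin 2 → V := ![τ.symm (v (Fin.last g)), ∑ l, p l • v l] with hx
  set M := monodromy z u p q r with hM
  have hstate {n : ℕ} (hn : n ≤ g) := transferState_of_isBlochSolution hu hv hn
  have hlast := (isBlochSolution_iff _ _ _ _ _ _).1 hv (Fin.last g)
  have hβ : ∑ l, p l • v l - partialSum p v g = p (Fin.last g) • v (Fin.last g) := by
    have := partialSum_succ p v (Fin.last g)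
    rw [Fin.val_last, partialSum_full] at this
    rw [this]; abel
  have hrv : v (Fin.last g) = r • (p (Fin.last g) • v (Fin.last g)) := by
    rw [smul_smul, mul_comm, hr, one_smul]
  rw [if_pos rfl, Fin.snoc_last, sub_zero, Fin.val_last, hβ] at hlast
  -- one period of the recursion acts on the initial state as `τ`
  have hMx : Mᵀ • x = fun i => τ (x i) := by
    rw [hM, monodromy_transpose_smul, hx, hstate le_rfl, transferLast_transpose_smul, hβ]
    funext i
    fin_cases i
    · simp [← hrv]
    · have h2 : τ (∑ l, p l • v l) = z • v (Fin.last g) -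
          p (Fin.last g) • (τ.symm (v (Fin.last g)) + partialSum q v g)
          - q (Fin.last g) • p (Fin.last g) • v (Fin.last g) := by
        rw [hlast]; abel
      simp only [Fin.mk_one, Matrix.cons_val_one, Matrix.cons_val_zero, Matrix.cons_val_fin_one, h2]
      rw [mul_smul _ r, ← hrv]
      module
  -- `L` is the operator whose vanishing on every `v m` is claimed
  set L : V →ₗ[K] V := (τ : V →ₗ[K] V) + (τ.symm : V →ₗ[K] V) - M.trace • LinearMap.id with hL
  have hLτ (y : V) : L (τ y) = τ (L y) := by simp [hL]
  -- Cayley–Hamilton with `det M = 1` reads `τ² x - Δ τ x + x = 0`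
  have hLx (i : Fin 2) : L (x i) = 0 := by
    have hch := smul_smul_fin_two Mᵀ x
    rw [trace_transpose, det_transpose, hM, det_monodromy _ _ _ _ _ hr, ← hM, one_smul] at hch
    have hi := congrFun hch i
    rw [hMx] at hi
    have h3 : (Mᵀ • fun i => τ (x i)) i = τ (τ (x i)) := by
      have := map_matrix_smul (τ : V →ₗ[K] V) Mᵀ x i
      rw [hMx] at this
      exact this.symm
    rw [h3] at hi
    apply τ.injective
    simp only [Pi.sub_apply, Pi.smul_apply] at hi
    simp [hL, hi]
  have hLn (n : ℕ) (i : Fin 2) : L (transferState u p q x n i) = 0 := by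
    rw [transferState, map_matrix_smul, show (fun j => L (x j)) = 0 from funext hLx]
    simp
  have hLv : L (v m) = 0 := by
    refine Fin.lastCases ?_ (fun k => ?_) m
    · have : v (Fin.last g) = τ (x 0) := by simp [hx]
      rw [this, hLτ, hLx, map_zero]
    · have hb := (isBlochSolution_iff _ _ _ _ _ _).1 hv k.castSucc
      rw [if_neg (Fin.castSucc_lt_last _).ne, add_zero, Fin.snoc_castSucc] at hb
      have hw : v k.castSucc = (-u k) • ((z - C k) • v k.castSucc) := by
        rw [smul_smul, show -u k * (z - C k) = 1 by linear_combination hu k, one_smul]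
      have hs := hstate k.is_le'
      have h0 := hLn k 0
      have h1 := hLn k 1
      rw [hx, hs] at h0 h1
      simp only [Matrix.cons_val_zero, Matrix.cons_val_one] at h0 h1
      rw [hw, hb]
      simp only [map_smul, map_add, Fin.val_castSucc] at h0 h1 ⊢
      rw [h1, h0]
      simp
  simpa [hL, sub_eq_zero] using hLv

/-- Conversely, an initial state that one period of the transfer recursion multiplies by `τ` comes
from a Bloch solution. -/
theorem exists_isBlochSolution (hu : ∀ k, u k * (C k - z) = 1) (hr : p (Fin.last g) * r = 1)
    {x : Fin 2 → V} (hx : (monodromy z u p q r)ᵀ • x = fun i => τ (x i)) :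
    ∃ v : Fin (g + 1) → V, IsBlochSolution z (Fin.snoc C 0 : Fin (g + 1) → K) p q τ v ∧
      x 0 = τ.symm (v (Fin.last g)) ∧ x 1 = ∑ l, p l • v l := by
  set X := transferState u p q x with hX
  set v : Fin (g + 1) → V := Fin.snoc (α := fun _ => V)
    (fun k : Fin g => (-u k) • (p k.castSucc • X k 0 + q k.castSucc • X k 1)) (r • X g 1) with hv
  have hvk (k : Fin g) : v k.castSucc
      = (-u k) • (p k.castSucc • X k 0 + q k.castSucc • X k 1) := by
    rw [hv, Fin.snoc_castSucc]
  have hvg : v (Fin.last g) = r • X g 1 := by rw [hv, Fin.snoc_last]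
  have hsum {n : ℕ} (hn : n ≤ g) : X n 0 = x 0 + partialSum q v n ∧
      X n 1 = x 1 - partialSum p v n := by
    induction n with
    | zero => simp [hX, transferState_zero, partialSum_zero]
    | succ n ih =>
      obtain ⟨h0, h1⟩ := ih (by omega)
      have h := transferState_succ u p q x ⟨n, hn⟩
      rw [transferFactor_transpose_smul, ← hX] at h
      have hvn := hvk ⟨n, hn⟩
      have hq := partialSum_succ q v (Fin.castSucc ⟨n, hn⟩)
      have hp := partialSum_succ p v (Fin.castSucc ⟨n, hn⟩)
      simp only [Fin.val_castSucc] at hq hp h hvn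
      rw [← hvn] at h
      rw [h, hq, hp]
      simp [h0, h1, add_assoc, sub_sub]
  have hx' := hx
  rw [monodromy_transpose_smul, transferLast_transpose_smul, ← hX] at hx'
  have e0 : v (Fin.last g) = τ (x 0) := by simpa [hvg] using congrFun hx' 0
  have e1 := congrFun hx' 1
  simp only [Matrix.cons_val_one, Matrix.cons_val_fin_one] at e1
  have hpv : p (Fin.last g) • v (Fin.last g) = X g 1 := by
    rw [hvg, smul_smul, hr, one_smul]
  have hx1 : x 1 = ∑ l, p l • v l := by
    have := partialSum_succ p v (Fin.last g)
    rw [Fin.val_last, partialSum_full, hpv, (hsum le_rfl).2] at this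
    rw [this]; abel
  have hx0 : x 0 = τ.symm (v (Fin.last g)) := by rw [e0]; simp
  refine ⟨v, (isBlochSolution_iff _ _ _ _ _ _).2 fun m => ?_, hx0, hx1⟩
  rw [← hx0, ← hx1]
  refine Fin.lastCases ?_ (fun k => ?_) m
  · rw [if_pos rfl, ← e1, Fin.val_last, ← (hsum le_rfl).1, ← (hsum le_rfl).2, mul_smul _ r, ← hvg,
      ← hpv, Fin.snoc_last]
    module
  · rw [if_neg (Fin.castSucc_lt_last _).ne, add_zero, Fin.snoc_castSucc, Fin.val_castSucc,
      ← (hsum k.is_le').1, ← (hsum k.is_le').2, hvk, smul_smul,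
      show (z - C k) * -u k = 1 by linear_combination hu k, one_smul]

end Transfer

/-! ### The standard basis and the translation by one block -/

section Shift

theorem e_apply (n m : ℤ) : (e n : ℤ → ℂ) m = if m = n then 1 else 0 := by
  simp [e, Pi.single_apply]

/-- The standard basis of `ℓ²(ℤ)` as a Hilbert basis. -/
def stdBasis : HilbertBasis ℤ ℂ EllTwo := HilbertBasis.ofRepr (LinearIsometryEquiv.refl ℂ EllTwo)

theorem coe_stdBasis : (stdBasis : ℤ → EllTwo) = e := by
  funext n
  rw [← HilbertBasis.repr_symm_single]
  rfl

theorem orthonormal_e : Orthonormal ℂ e := coe_stdBasis ▸ stdBasis.orthonormal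

theorem dense_span_e : (Submodule.span ℂ (Set.range e)).topologicalClosure = ⊤ :=
  coe_stdBasis ▸ stdBasis.dense_span

theorem inner_e_left (n : ℤ) (f : EllTwo) : ⟪e n, f⟫_ℂ = f n := by
  simp [e, lp.inner_single_left]

theorem ext_of_apply_e {S T : EllTwo →L[ℂ] EllTwo} (h : ∀ n, S (e n) = T (e n)) : S = T :=
  ContinuousLinearMap.ext_on (Submodule.dense_iff_topologicalClosure_eq_top.2 dense_span_e)
    (by rintro _ ⟨n, rfl⟩; exact h n)

theorem summable_norm_sq (f : EllTwo) : Summable fun n => ‖(f : ℤ → ℂ) n‖ ^ 2 := by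
  have := (lp.memℓp f).summable (by norm_num)
  simpa using this

theorem tendsto_apply_zero {ι : Type*} {l : Filter ι} {φ : ι → ℤ} (hφ : Function.Injective φ)
    (hl : l ≤ Filter.cofinite) (f : EllTwo) :
    Filter.Tendsto (fun i => (f : ℤ → ℂ) (φ i)) l (nhds 0) := by
  have h := (summable_norm_sq f).tendsto_cofinite_zero
  have h2 : Filter.Tendsto (fun n => ‖(f : ℤ → ℂ) n‖) Filter.cofinite (nhds 0) := by
    simpa using h.sqrt
  exact (tendsto_zero_iff_norm_tendsto_zero.2 h2).comp (hφ.tendsto_cofinite.mono_left hl)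

variable (g : ℕ)

/-- The translation `S^{g+1}` of `ℓ²(ℤ)` by one block. -/
def blockShift : EllTwo ≃ₗᵢ[ℂ] EllTwo :=
  (HilbertBasis.mk (v := fun n : ℤ => e (n + (g + 1)))
    (orthonormal_e.comp _ (add_left_injective _)) (by
      have : Set.range (fun n : ℤ => e (n + (g + 1))) = Set.range e :=
        (Equiv.addRight ((g : ℤ) + 1)).surjective.range_comp e
      rw [this, dense_span_e])).repr.symm

theorem blockShift_e (n : ℤ) : blockShift g (e n) = e (n + (g + 1)) := by
  rw [blockShift, e, HilbertBasis.repr_symm_single, HilbertBasis.coe_mk]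

theorem blockShift_symm_e (n : ℤ) : (blockShift g).symm (e n) = e (n - (g + 1)) := by
  rw [LinearIsometryEquiv.symm_apply_eq, blockShift_e, sub_add_cancel]

theorem blockShift_apply (f : EllTwo) (n : ℤ) : (blockShift g f) n = f (n - (g + 1)) := by
  rw [← inner_e_left, ← inner_e_left, ← blockShift_symm_e, ← (blockShift g).symm.inner_map_map,
    LinearIsometryEquiv.symm_apply_apply]

end Shift

/-! ### Periodic matrices of the class `𝔸` -/

section Periodic

variable {g : ℕ}

theorem exists_block_index (g : ℕ) (n : ℤ) :
    ∃ (j : ℤ) (l : Fin (g + 1)), n = j * (g + 1) + (l : ℕ) := by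
  have hN : (0 : ℤ) < g + 1 := by positivity
  have h0 := Int.emod_nonneg n hN.ne'
  have h1 := Int.emod_lt_of_pos n hN
  refine ⟨n / (g + 1), ⟨(n % (g + 1)).toNat, by omega⟩, ?_⟩
  rw [Int.toNat_of_nonneg h0]
  linarith [Int.mul_ediv_add_emod n (g + 1), mul_comm (n / ((g : ℤ) + 1)) (g + 1)]

theorem block_index_inj {j k : ℤ} {l m : Fin (g + 1)} :
    j * (g + 1) + (l : ℕ) = k * (g + 1) + ((m : ℕ) : ℤ) ↔ j = k ∧ l = m := by
  refine ⟨fun h => ?_, fun ⟨h1, h2⟩ => by rw [h1, h2]⟩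
  have hl := l.2
  have hm := m.2
  have hj : j = k := by
    rcases lt_trichotomy j k with hh | hh | hh
    · nlinarith
    · exact hh
    · nlinarith
  subst hj
  exact ⟨rfl, Fin.ext (by omega)⟩

theorem e_block_apply (j k : ℤ) (l m : Fin (g + 1)) :
    (e (k * (g + 1) + (m : ℕ)) : ℤ → ℂ) (j * (g + 1) + (l : ℕ))
      = if j = k ∧ l = m then 1 else 0 := by
  simp [e_apply, block_index_inj]

theorem diagBlock_symm (C : Fin g → ℝ) (p q : Fin (g + 1) → ℝ) (l m : Fin (g + 1)) :
    diagBlock C p q l m = diagBlock C p q m l := by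
  rcases lt_trichotomy l m with h | rfl | h
  · simp [diagBlock, h, h.not_gt, Matrix.vecMulVec_apply, h.ne, h.ne', mul_comm]
  · rfl
  · simp [diagBlock, h, h.not_gt, Matrix.vecMulVec_apply, h.ne, h.ne', mul_comm]

variable {C : Fin g → ℝ} {p q : Fin (g + 1) → ℝ} {A : EllTwo →L[ℂ] EllTwo}

theorem matrixOf_apply (A : EllTwo →L[ℂ] EllTwo) (m n : ℤ) : matrixOf A m n = (A (e n)) m := rfl

theorem IsPeriodicWith.matrixOf_apply (h : IsPeriodicWith C p q A) (j k : ℤ) (l m : Fin (g + 1)) :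
    matrixOf A (j * (g + 1) + (l : ℕ)) (k * (g + 1) + (m : ℕ)) =
      ((if j = k then diagBlock C p q l m else if k = j + 1 then offDiagBlock p l m
        else if k = j - 1 then offDiagBlock p m l else 0 : ℝ) : ℂ) := by
  change block g (matrixOf A) j k l m = _
  split_ifs with h1 h2 h3
  · subst h1; rw [h.diag]; rfl
  · subst h2; rw [h.upper]; rfl
  · subst h3; rw [h.lower]; rfl
  · rw [h.far j k ?_]
    · simp
    · rw [lt_abs]; omega

theorem IsPeriodicWith.matrixOf_symm (h : IsPeriodicWith C p q A) (m n : ℤ) :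
    matrixOf A m n = (starRingEnd ℂ) (matrixOf A n m) := by
  obtain ⟨j, l, rfl⟩ := exists_block_index g m
  obtain ⟨k, l', rfl⟩ := exists_block_index g n
  rw [h.matrixOf_apply, h.matrixOf_apply, Complex.conj_ofReal]
  congr 1
  rcases eq_or_ne j k with rfl | h1
  · simp [diagBlock_symm C p q l l']
  · rw [if_neg h1, if_neg h1.symm]
    by_cases h2 : k = j + 1
    · subst h2; simp; omega
    · by_cases h3 : k = j - 1
      · subst h3; simp; omega
      · rw [if_neg h2, if_neg h3, if_neg (by omega), if_neg (by omega)]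

theorem IsPeriodicWith.isSelfAdjoint (h : IsPeriodicWith C p q A) : IsSelfAdjoint A := by
  rw [IsSelfAdjoint, ContinuousLinearMap.star_eq_adjoint]
  refine ext_of_apply_e fun n => ?_
  ext m
  rw [← inner_e_left, ContinuousLinearMap.adjoint_inner_right, ← inner_conj_symm, inner_e_left]
  exact (h.matrixOf_symm m n).symm

theorem IsPeriodicWith.blockShift_apply (h : IsPeriodicWith C p q A) (f : EllTwo) :
    A (blockShift g f) = blockShift g (A f) := by
  suffices A ∘L (blockShift g).toContinuousLinearEquiv.toContinuousLinearMap
      = (blockShift g).toContinuousLinearEquiv.toContinuousLinearMap ∘L A from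
    congrArg (fun S : EllTwo →L[ℂ] EllTwo => S f) this
  refine ext_of_apply_e fun n => ?_
  change A (blockShift g (e n)) = blockShift g (A (e n))
  ext m
  rw [GMP.blockShift_apply, blockShift_e, ← GMP.matrixOf_apply, ← GMP.matrixOf_apply]
  obtain ⟨j, l, rfl⟩ := exists_block_index g m
  obtain ⟨k, l', rfl⟩ := exists_block_index g n
  rw [show k * ((g : ℤ) + 1) + (l' : ℕ) + (g + 1) = (k + 1) * (g + 1) + (l' : ℕ) by ring,
    show j * ((g : ℤ) + 1) + (l : ℕ) - (g + 1) = (j - 1) * (g + 1) + (l : ℕ) by ring,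
    h.matrixOf_apply, h.matrixOf_apply]
  congr 1
  simp only [show (j = k + 1) = (j - 1 = k) by apply propext; omega,
    show (k + 1 = j + 1) = (k = j - 1 + 1) by apply propext; omega,
    show (k + 1 = j - 1) = (k = j - 1 - 1) by apply propext; omega]

/-- The action of a periodic matrix on the basis vectors of the block `0`. -/
theorem IsPeriodicWith.apply_e (h : IsPeriodicWith C p q A) (m : Fin (g + 1)) :
    A (e (m : ℕ)) = (((Fin.snoc C 0 : Fin (g + 1) → ℝ) m : ℝ) : ℂ) • e (m : ℕ)
      + (p m : ℂ) • (blockShift g).symm (e (Fin.last g : ℕ))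
      + ∑ l : Fin (g + 1), ((if l < m then q l * p m else p l * q m : ℝ) : ℂ) • e (l : ℕ)
      + if m = Fin.last g then blockShift g (∑ l : Fin (g + 1), (p l : ℂ) • e (l : ℕ)) else 0 := by
  have e0 (l : Fin (g + 1)) : e ((l : ℕ) : ℤ) = e (0 * (g + 1) + (l : ℕ)) := by simp
  have e1 (l : Fin (g + 1)) : blockShift g (e ((l : ℕ) : ℤ)) = e (1 * (g + 1) + (l : ℕ)) := by
    rw [blockShift_e]; congr 1; ring
  have e2 (l : Fin (g + 1)) : (blockShift g).symm (e ((l : ℕ) : ℤ))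
      = e ((-1) * (g + 1) + (l : ℕ)) := by
    rw [blockShift_symm_e]; congr 1; ring
  simp only [map_sum, map_smul]
  simp only [e1, e2]
  simp only [e0]
  ext n
  obtain ⟨j, l, rfl⟩ := exists_block_index g n
  rw [← GMP.matrixOf_apply, h.matrixOf_apply]
  have hsum (a : Fin (g + 1) → ℂ) (k : ℤ) :
      ((∑ x : Fin (g + 1), a x • e (k * (g + 1) + (x : ℕ)) : EllTwo) : ℤ → ℂ)
        (j * (g + 1) + (l : ℕ)) = if j = k then a l else 0 := by
    rw [lp.coeFn_sum, Finset.sum_apply]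
    simp only [lp.coeFn_smul, Pi.smul_apply, e_block_apply, smul_eq_mul, mul_ite, mul_one, mul_zero]
    by_cases hjk : j = k <;> simp [hjk]
  have hite : ((if m = Fin.last g then
      (∑ x : Fin (g + 1), (p x : ℂ) • e (1 * (g + 1) + (x : ℕ))) else 0 : EllTwo) : ℤ → ℂ)
        (j * (g + 1) + (l : ℕ))
      = if m = Fin.last g then (if j = 1 then (p l : ℂ) else 0) else 0 := by
    split_ifs with h1 h2
    · rw [hsum, if_pos h2]
    · rw [hsum, if_neg h2]
    · rfl
  simp only [lp.coeFn_add, lp.coeFn_smul, Pi.add_apply, Pi.smul_apply, smul_eq_mul, e_block_apply,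
    hsum, hite]
  by_cases h0 : j = 0
  · subst h0
    simp [diagBlock, Matrix.vecMulVec_apply, Matrix.diagonal_apply]
    split_ifs <;> simp_all [add_comm]
  by_cases h1 : j = 1
  · subst h1
    simp [offDiagBlock, Matrix.vecMulVec_apply, Pi.single_apply, apply_ite Complex.ofReal]
  by_cases h2 : j = -1
  · subst h2
    simp [offDiagBlock, Matrix.vecMulVec_apply, Pi.single_apply, apply_ite Complex.ofReal]
  · rw [if_neg h0, if_neg (by omega), if_neg (by omega)]
    simp [h0, h1, h2]

end Periodic

/-! ### The discriminant on the real line -/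

section RealDiscriminant

variable {g : ℕ}

/-- The discriminant as a real function of a real variable. -/
def realDiscriminant (C : Fin g → ℝ) (p q : Fin (g + 1) → ℝ) (x : ℝ) : ℝ :=
  (monodromy x (fun k => (C k - x)⁻¹) p q (p (Fin.last g))⁻¹).trace

theorem discriminant_ofReal (C : Fin g → ℝ) (p q : Fin (g + 1) → ℝ) (x : ℝ) :
    discriminant C p q x = (realDiscriminant C p q x : ℂ) := by
  have := map_trace_monodromy Complex.ofRealHom x (fun k => (C k - x)⁻¹) p q (p (Fin.last g))⁻¹
  rw [discriminant_eq_trace_monodromy, realDiscriminant]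
  simpa using this.symm

theorem differentiableAt_list_prod_apply {n : ℕ} {x₀ : ℝ}
    (L : List (ℝ → Matrix (Fin n) (Fin n) ℝ))
    (hL : ∀ F ∈ L, ∀ i j, DifferentiableAt ℝ (fun x => F x i j) x₀) (i j : Fin n) :
    DifferentiableAt ℝ (fun x => (L.map fun F => F x).prod i j) x₀ := by
  induction L generalizing i j with
  | nil => simp
  | cons F L ih =>
    simp only [List.map_cons, List.prod_cons, Matrix.mul_apply]
    refine DifferentiableAt.fun_sum fun k _ => ?_
    exact (hL F (by simp) i k).mul (ih (fun G hG => hL G (by simp [hG])) k j)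

theorem differentiableAt_realDiscriminant (C : Fin g → ℝ) (p q : Fin (g + 1) → ℝ) {x₀ : ℝ}
    (hx : ∀ k, x₀ ≠ C k) : DifferentiableAt ℝ (realDiscriminant C p q) x₀ := by
  have hfac (i j : Fin 2) : DifferentiableAt ℝ
      (fun x => (transferList (fun k => (C k - x)⁻¹) p q).prod i j) x₀ := by
    have := differentiableAt_list_prod_apply (x₀ := x₀) (List.ofFn fun k : Fin g => fun x : ℝ =>
      transferFactor (C k - x)⁻¹ (p k.castSucc) (q k.castSucc)) (fun F hF i j => by
        obtain ⟨k, rfl⟩ := (List.mem_ofFn' _ _).1 hF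
        have hk : DifferentiableAt ℝ (fun x : ℝ => (C k - x)⁻¹) x₀ :=
          ((differentiableAt_const _).sub differentiableAt_id).inv (sub_ne_zero.2 (hx k).symm)
        fin_cases i <;> fin_cases j <;> simp [transferFactor] <;> fun_prop) i j
    simpa only [transferList, List.map_ofFn, Function.comp_def] using this
  have hlast (i j : Fin 2) : DifferentiableAt ℝ (fun x : ℝ => transferLast x (p (Fin.last g))
      (q (Fin.last g)) (p (Fin.last g))⁻¹ i j) x₀ := by
    fin_cases i <;> fin_cases j <;> simp [transferLast]
  unfold realDiscriminant
  simp only [monodromy, Matrix.trace_fin_two, Matrix.mul_apply, Fin.sum_univ_two]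
  exact (((hfac 0 0).mul (hlast 0 0)).add ((hfac 0 1).mul (hlast 1 0))).add
    (((hfac 1 0).mul (hlast 0 1)).add ((hfac 1 1).mul (hlast 1 1)))

end RealDiscriminant

/-! ### The discriminant of the operator -/

section OperatorDiscriminant

variable {H : Type*} [NormedAddCommGroup H] [InnerProductSpace ℂ H] [CompleteSpace H]

/-- A periodic self-adjoint operator `A` on a Hilbert space, described by the translation `T` by one
block and an orthonormal basis `b`, whose vector `b (j, l)` has the index `l` in the block `j`. The
points `C` lie outside the spectrum. The
Hilbert space is kept abstract because `ℓ²(ℤ)` carries a second real vector space structure,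
inherited from `lp` and not reducibly equal to the one that the functional calculus uses. -/
structure IsPeriodicOperator {g : ℕ} (C : Fin g → ℝ) (p q : Fin (g + 1) → ℝ) (A : H →L[ℂ] H)
    (T : H ≃ₗᵢ[ℂ] H) (b : ℤ × Fin (g + 1) → H) : Prop where
  isSelfAdjoint : IsSelfAdjoint A
  map_shift : ∀ f, A (T f) = T (A f)
  shift_apply : ∀ j l, T (b (j, l)) = b (j + 1, l)
  apply_zero : ∀ m, A (b (0, m)) = (((Fin.snoc C 0 : Fin (g + 1) → ℝ) m : ℝ) : ℂ) • b (0, m)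
    + (p m : ℂ) • T.symm (b (0, Fin.last g))
    + ∑ l : Fin (g + 1), ((if l < m then q l * p m else p l * q m : ℝ) : ℂ) • b (0, l)
    + if m = Fin.last g then T (∑ l : Fin (g + 1), (p l : ℂ) • b (0, l)) else 0
  orthonormal : Orthonormal ℂ b
  dense : (Submodule.span ℂ (Set.range b)).topologicalClosure = ⊤
  last_pos : 0 < p (Fin.last g)
  isUnit : ∀ k : Fin g, IsUnit (algebraMap ℂ (H →L[ℂ] H) (C k) - A)

namespace IsPeriodicOperator

variable {g : ℕ} {C : Fin g → ℝ} {p q : Fin (g + 1) → ℝ} {A : H →L[ℂ] H} {T : H ≃ₗᵢ[ℂ] H}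
  {b : ℤ × Fin (g + 1) → H}

theorem ne_of_mem_spectrum (h : IsPeriodicOperator C p q A T b) {x : ℝ} (hx : x ∈ spectrum ℝ A)
    (k : Fin g) : x ≠ C k := by
  rintro rfl
  refine spectrum.mem_iff.1 hx ?_
  rw [IsScalarTower.algebraMap_apply ℝ ℂ]
  exact h.isUnit k

theorem continuousOn_realDiscriminant (h : IsPeriodicOperator C p q A T b) :
    ContinuousOn (realDiscriminant C p q) (spectrum ℝ A) := fun _ hx =>
  (differentiableAt_realDiscriminant C p q
    (h.ne_of_mem_spectrum hx)).continuousAt.continuousWithinAt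

theorem cfc_shift (h : IsPeriodicOperator C p q A T b) (φ : ℝ → ℝ) (f : H) :
    cfc φ A (T f) = T (cfc φ A f) := by
  have hc : Commute A T.toContinuousLinearEquiv.toContinuousLinearMap := by
    ext1 f
    exact h.map_shift f
  exact congrArg (fun S : H →L[ℂ] H => S f) (hc.cfc_real φ).eq

/-- On the vectors of the block `0` the discriminant of `A` acts as the sum of the translations by
one block in both directions. The functional calculus makes the Hilbert space a module over the
continuous functions on the spectrum, and the vectors of the block `0` form a Bloch solution in this
module whose spectral parameter is the identity function. -/
theorem cfc_realDiscriminant_block_zero (h : IsPeriodicOperator C p q A T b) (m : Fin (g + 1)) :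
    cfc (realDiscriminant C p q) A (b (0, m)) = T (b (0, m)) + T.symm (b (0, m)) := by
  have hA := h.isSelfAdjoint
  let φ : C(spectrum ℝ A, ℝ) →⋆ₐ[ℝ] (H →L[ℂ] H) := cfcHom hA
  let _ : Module C(spectrum ℝ A, ℝ) H :=
    Module.compHom H (φ : C(spectrum ℝ A, ℝ) →+* (H →L[ℂ] H))
  have hsmul (k : C(spectrum ℝ A, ℝ)) (f : H) : k • f = φ k f := rfl
  have hext (k : C(spectrum ℝ A, ℝ)) : ∃ ψ : ℝ → ℝ, φ k = cfc ψ A :=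
    ⟨_, cfcHom_eq_cfc_extend 0 hA k⟩
  let τ : H ≃ₗ[C(spectrum ℝ A, ℝ)] H :=
    { toFun := T
      invFun := T.symm
      left_inv := fun f => by simp
      right_inv := fun f => by simp
      map_add' := fun f f' => by simp
      map_smul' := fun k f => by
        obtain ⟨ψ, hψ⟩ := hext k
        rw [RingHom.id_apply, hsmul, hsmul, hψ, h.cfc_shift] }
  have hτ (f : H) : τ f = T f := rfl
  have hτs (f : H) : τ.symm f = T.symm f := rfl
  let z : C(spectrum ℝ A, ℝ) := (ContinuousMap.id ℝ).restrict (spectrum ℝ A)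
  let ι := algebraMap ℝ C(spectrum ℝ A, ℝ)
  have hι (r : ℝ) (f : H) : ι r • f = (r : ℂ) • f := by
    rw [hsmul, show φ (ι r) = algebraMap ℝ (H →L[ℂ] H) r from AlgHomClass.commutes φ r,
      Algebra.algebraMap_eq_smul_one]
    exact (Complex.coe_smul r f).symm
  let u : Fin g → C(spectrum ℝ A, ℝ) := fun k =>
    ⟨fun x => (C k - x)⁻¹, by
      refine Continuous.inv₀ (by fun_prop) fun x => ?_
      exact sub_ne_zero.2 (h.ne_of_mem_spectrum x.2 k).symm⟩
  have huz (k : Fin g) : u k * (ι (C k) - z) = 1 := by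
    ext x
    exact inv_mul_cancel₀ (sub_ne_zero.2 (h.ne_of_mem_spectrum x.2 k).symm)
  have hr : ι (p (Fin.last g)) * ι (p (Fin.last g))⁻¹ = 1 := by
    rw [← map_mul, mul_inv_cancel₀ h.last_pos.ne', map_one]
  have hB : IsBlochSolution z (Fin.snoc (fun k => ι (C k)) 0 : Fin (g + 1) → C(spectrum ℝ A, ℝ))
      (fun k => ι (p k)) (fun k => ι (q k)) τ (fun l => b (0, l)) := by
    intro m
    have hsn : (Fin.snoc (fun k => ι (C k)) 0 : Fin (g + 1) → C(spectrum ℝ A, ℝ)) m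
        = ι ((Fin.snoc C 0 : Fin (g + 1) → ℝ) m) := by
      refine Fin.lastCases ?_ (fun k => ?_) m
      · simp
      · simp
    have hz : z • b (0, m) = A (b (0, m)) := by
      rw [hsmul]
      exact congrArg (fun S : H →L[ℂ] H => S (b (0, m))) (cfcHom_id hA)
    have hif (l : Fin (g + 1)) : (if l < m then ι (q l) * ι (p m) else ι (p l) * ι (q m))
        = ι (if l < m then q l * p m else p l * q m) := by
      split_ifs <;> simp
    simp only [hif, hι, hτ, hτs]
    rw [sub_smul, hsn, hι, hz, h.apply_zero]
    abel
  have key := add_symm_eq_trace_smul_of_isBlochSolution huz hr hB m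
  rw [hτ, hτs, hsmul] at key
  rw [key, cfc_apply _ _ hA h.continuousOn_realDiscriminant]
  congr 2
  ext x
  have := map_trace_monodromy (ContinuousMap.evalStarAlgHom ℝ ℝ x : C(spectrum ℝ A, ℝ) →+* ℝ)
    z u (fun k => ι (p k)) (fun k => ι (q k)) (ι (p (Fin.last g))⁻¹)
  exact this.symm

theorem ext_of_apply_basis (h : IsPeriodicOperator C p q A T b) {R S : H →L[ℂ] H}
    (hRS : ∀ i, R (b i) = S (b i)) : R = S :=
  ContinuousLinearMap.ext_on (Submodule.dense_iff_topologicalClosure_eq_top.2 h.dense)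
    (by rintro _ ⟨i, rfl⟩; exact hRS i)

/-- The discriminant of `A` is the sum of the translations by one block in both directions. -/
theorem cfc_realDiscriminant (h : IsPeriodicOperator C p q A T b) :
    cfc (realDiscriminant C p q) A = T.toContinuousLinearEquiv.toContinuousLinearMap
      + T.symm.toContinuousLinearEquiv.toContinuousLinearMap := by
  refine h.ext_of_apply_basis fun ⟨j, l⟩ => ?_
  change cfc (realDiscriminant C p q) A (b (j, l)) = T (b (j, l)) + T.symm (b (j, l))
  induction j using Int.induction_on with
  | zero => exact h.cfc_realDiscriminant_block_zero l
  | succ j ih =>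
    rw [← h.shift_apply, h.cfc_shift, ih]
    simp
  | pred j ih =>
    have : T (b (-j - 1, l)) = b (-j, l) := by
      rw [h.shift_apply, sub_add_cancel]
    apply T.injective
    rw [← h.cfc_shift, this, ih, map_add, LinearIsometryEquiv.apply_symm_apply]
    nth_rewrite 2 [← this]
    rw [LinearIsometryEquiv.symm_apply_apply]

theorem norm_cfc_realDiscriminant_le (h : IsPeriodicOperator C p q A T b) :
    ‖cfc (realDiscriminant C p q) A‖ ≤ 2 := by
  refine ContinuousLinearMap.opNorm_le_bound _ (by norm_num) fun f => ?_
  rw [h.cfc_realDiscriminant]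
  refine (norm_add_le (T f) (T.symm f)).trans ?_
  rw [LinearIsometryEquiv.norm_map, LinearIsometryEquiv.norm_map]
  linarith

theorem realDiscriminant_mem_Icc (h : IsPeriodicOperator C p q A T b) {x : ℝ}
    (hx : x ∈ spectrum ℝ A) : realDiscriminant C p q x ∈ Set.Icc (-2 : ℝ) 2 := by
  have := norm_apply_le_norm_cfc (realDiscriminant C p q) A hx h.continuousOn_realDiscriminant
    h.isSelfAdjoint
  exact abs_le.1 (this.trans h.norm_cfc_realDiscriminant_le)

theorem exists_discriminant_eq_of_mem_spectrum (h : IsPeriodicOperator C p q A T b) {z : ℂ}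
    (hz : z ∈ spectrum ℂ A) : (∀ k, z ≠ (C k : ℂ)) ∧
      ∃ x : ℝ, x ∈ Set.Icc (-2 : ℝ) 2 ∧ discriminant C p q z = (x : ℂ) := by
  have hre := h.isSelfAdjoint.mem_spectrum_eq_re hz
  have hz' : z.re ∈ spectrum ℝ A := by
    rw [← spectrum.preimage_algebraMap ℂ]
    rw [hre] at hz
    exact hz
  refine ⟨fun k hk => hz (hk ▸ h.isUnit k), _, h.realDiscriminant_mem_Icc hz', ?_⟩
  rw [← discriminant_ofReal, ← hre]

end IsPeriodicOperator

end OperatorDiscriminant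

/-! ### The spectrum -/

section Spectrum

variable {g : ℕ} {C : Fin g → ℝ} {p q : Fin (g + 1) → ℝ} {A : EllTwo →L[ℂ] EllTwo}

/-- A periodic GMP matrix is a periodic operator with respect to the standard basis, split into
blocks. -/
theorem IsGMP.isPeriodicOperator (hA : IsGMP C A) (h : IsPeriodicWith C p q A) :
    IsPeriodicOperator C p q A (blockShift g) fun i => e (i.1 * (g + 1) + (i.2 : ℕ)) where
  isSelfAdjoint := h.isSelfAdjoint
  map_shift := h.blockShift_apply
  shift_apply j l := by rw [blockShift_e]; congr 1; ring
  apply_zero m := by simpa using h.apply_e m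
  orthonormal := orthonormal_e.comp _ fun i i' hi => Prod.ext_iff.2 (block_index_inj.1 hi)
  dense := by
    have hsurj : Function.Surjective fun i : ℤ × Fin (g + 1) => i.1 * (g + 1) + ((i.2 : ℕ) : ℤ) :=
      fun n => by
        obtain ⟨j, l, rfl⟩ := exists_block_index g n
        exact ⟨(j, l), rfl⟩
    rw [show (Set.range fun i : ℤ × Fin (g + 1) => e (i.1 * (g + 1) + ((i.2 : ℕ) : ℤ)))
      = Set.range e from hsurj.range_comp e, dense_span_e]
  last_pos := h.last_pos 0
  isUnit := hA.isUnit

theorem exists_norm_one_add_inv {x : ℝ} (hx : x ∈ Set.Icc (-2 : ℝ) 2) :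
    ∃ w : ℂ, ‖w‖ = 1 ∧ w + w⁻¹ = x := by
  refine ⟨Complex.exp (Real.arccos (x / 2) * Complex.I), Complex.norm_exp_ofReal_mul_I _, ?_⟩
  have hc : Real.cos (Real.arccos (x / 2)) = x / 2 :=
    Real.cos_arccos (by linarith [hx.1]) (by linarith [hx.2])
  rw [← Complex.exp_neg, ← neg_mul]
  have h2 := Complex.two_cos (Real.arccos (x / 2))
  rw [← h2, ← Complex.ofReal_cos, hc]
  push_cast
  ring

open Matrix.Module in
/-- If the discriminant takes a value `w + w⁻¹` at `z`, the eigenvalue equation has a nonzero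
scalar Bloch solution with multiplier `w`. -/
theorem exists_scalar_isBlochSolution (hp : 0 < p (Fin.last g)) {z w : ℂ} (hw : w ≠ 0)
    (hz : ∀ k, z ≠ C k) (hd : discriminant C p q z = w + w⁻¹) :
    ∃ v : Fin (g + 1) → ℂ, v ≠ 0 ∧
      IsBlochSolution z (Fin.snoc (fun k => (C k : ℂ)) 0 : Fin (g + 1) → ℂ) (fun k => (p k : ℂ))
        (fun k => (q k : ℂ)) (LinearEquiv.smulOfNeZero ℂ ℂ w hw) v := by
  set M := monodromy z (fun k => ((C k : ℂ) - z)⁻¹) (fun k => (p k : ℂ))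
      (fun k => (q k : ℂ)) ((p (Fin.last g) : ℂ)⁻¹) with hM
  rw [discriminant_eq_trace_monodromy, ← hM] at hd
  have hr : (p (Fin.last g) : ℂ) * (p (Fin.last g) : ℂ)⁻¹ = 1 :=
    mul_inv_cancel₀ (by exact_mod_cast hp.ne')
  have hdet : M.det = 1 := det_monodromy _ _ _ _ _ hr
  -- `det M = 1` and `tr M = w + w⁻¹`, so that `w` is an eigenvalue
  have h0 : (M.transpose - w • (1 : Matrix (Fin 2) (Fin 2) ℂ)).det = 0 := by
    rw [Matrix.det_fin_two] at hdet
    rw [Matrix.trace_fin_two] at hd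
    have hww := mul_inv_cancel₀ hw
    simp [Matrix.det_fin_two]
    linear_combination hdet - w * hd - hww
  obtain ⟨x, hx0, hx⟩ := Matrix.exists_mulVec_eq_zero_iff.2 h0
  have hxM : M.transpose • x = fun i => LinearEquiv.smulOfNeZero ℂ ℂ w hw (x i) := by
    funext i
    have := congrFun hx i
    rw [Matrix.sub_mulVec, Matrix.smul_mulVec, Matrix.one_mulVec, Pi.sub_apply, Pi.zero_apply,
      sub_eq_zero] at this
    exact this
  obtain ⟨v, hv, hv0, hv1⟩ := exists_isBlochSolution (C := fun k => (C k : ℂ))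
    (fun k => inv_mul_cancel₀ (sub_ne_zero.2 (hz k).symm)) hr hxM
  refine ⟨v, ?_, hv⟩
  rintro rfl
  apply hx0
  funext i
  fin_cases i
  · simpa using hv0
  · simpa using hv1

/-- A sequence in `ℓ²(ℤ)` that is multiplied by a number of modulus one whenever the index moves
by one block in a fixed direction vanishes. -/
theorem apply_eq_zero_of_norm_eq (f : EllTwo) {φ : ℕ → ℤ} (hφ : Function.Injective φ)
    (hf : ∀ j, ‖(f : ℤ → ℂ) (φ (j + 1))‖ = ‖(f : ℤ → ℂ) (φ j)‖) : (f : ℤ → ℂ) (φ 0) = 0 := by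
  have hc (j : ℕ) : ‖(f : ℤ → ℂ) (φ j)‖ = ‖(f : ℤ → ℂ) (φ 0)‖ := by
    induction j with
    | zero => rfl
    | succ j ih => rw [hf, ih]
  have ht := (tendsto_apply_zero hφ Nat.cofinite_eq_atTop.ge f).norm
  simp only [hc, norm_zero] at ht
  exact norm_eq_zero.1 (tendsto_nhds_unique tendsto_const_nhds ht)

/-- A vector supported in the block `0` is not in the range of `S^{g+1} - w⁻¹` when `|w| = 1`,
unless it is zero. -/
theorem eq_zero_of_blockShift_sub {w : ℂ} (hw : ‖w‖ = 1) {v : Fin (g + 1) → ℂ} {f : EllTwo}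
    (hf : ∑ m : Fin (g + 1), v m • e (m : ℕ) = blockShift g f - w⁻¹ • f) : v = 0 := by
  have hw0 : w ≠ 0 := by rintro rfl; simp at hw
  have hcoord (j : ℤ) (l : Fin (g + 1)) : (if j = 0 then v l else 0) =
      (f : ℤ → ℂ) ((j - 1) * (g + 1) + (l : ℕ)) - w⁻¹ * (f : ℤ → ℂ) (j * (g + 1) + (l : ℕ)) := by
    have h1 := congrArg (fun x : EllTwo => (x : ℤ → ℂ) (j * (g + 1) + (l : ℕ))) hf
    have e0 (l : Fin (g + 1)) : e ((l : ℕ) : ℤ) = e (0 * (g + 1) + (l : ℕ)) := by simp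
    simp only [e0] at h1
    rw [lp.coeFn_sum, Finset.sum_apply] at h1
    simp only [lp.coeFn_smul, lp.coeFn_sub, Pi.sub_apply, Pi.smul_apply, e_block_apply,
      smul_eq_mul, mul_ite, mul_one, mul_zero, blockShift_apply] at h1
    rw [show j * ((g : ℤ) + 1) + (l : ℕ) - (g + 1) = (j - 1) * (g + 1) + (l : ℕ) by ring] at h1
    rw [← h1]
    by_cases hj : j = 0 <;> simp [hj]
  have hN : ((g : ℤ) + 1) ≠ 0 := by positivity
  funext l
  have hstep {j : ℤ} (hj : j ≠ 0) : ‖(f : ℤ → ℂ) ((j - 1) * (g + 1) + (l : ℕ))‖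
      = ‖(f : ℤ → ℂ) (j * (g + 1) + (l : ℕ))‖ := by
    have := hcoord j l
    rw [if_neg hj, eq_comm, sub_eq_zero] at this
    rw [this, norm_mul, norm_inv, hw, inv_one, one_mul]
  -- both `f` in the block `0` and `f` in the block `-1` start a half-line of constant modulus
  have h1 : (f : ℤ → ℂ) (0 * (g + 1) + (l : ℕ)) = 0 := by
    refine apply_eq_zero_of_norm_eq f (φ := fun j : ℕ => (j : ℤ) * (g + 1) + (l : ℕ)) ?_ ?_
    · intro a b hab
      simpa [hN] using hab
    · intro j
      have := hstep (j := j + 1) (by omega)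
      rw [add_sub_cancel_right] at this
      simpa using this.symm
  have h2 : (f : ℤ → ℂ) ((-1) * (g + 1) + (l : ℕ)) = 0 := by
    refine apply_eq_zero_of_norm_eq f (φ := fun j : ℕ => (-1 - (j : ℤ)) * (g + 1) + (l : ℕ)) ?_ ?_
    · intro a b hab
      simpa [hN] using hab
    · intro j
      have := hstep (j := -1 - j) (by omega)
      push_cast
      rw [show -1 - ((j : ℤ) + 1) = -1 - j - 1 by ring]
      exact this
  have := hcoord 0 l
  rw [h1, zero_sub, h2] at this
  simpa using this

/-- If `A - z` were invertible, the finitely supported vector made from a scalar Bloch solution at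
`z` would lie in the range of `S^{g+1} - w⁻¹`. -/
theorem mem_spectrum_of_discriminant (h : IsPeriodicWith C p q A) (hp : 0 < p (Fin.last g)) {z : ℂ}
    (hz : ∀ k, z ≠ C k) {x : ℝ} (hx : x ∈ Set.Icc (-2 : ℝ) 2)
    (hd : discriminant C p q z = x) : z ∈ spectrum ℂ A := by
  obtain ⟨w, hw, hwx⟩ := exists_norm_one_add_inv hx
  have hw0 : w ≠ 0 := by rintro rfl; simp at hw
  obtain ⟨v, hv0, hv⟩ := exists_scalar_isBlochSolution hp hw0 hz (hd.trans hwx.symm)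
  set E : EllTwo := ∑ m : Fin (g + 1), v m • e (m : ℕ) with hE
  set β : ℂ := ∑ l, (p l : ℂ) * v l with hβ
  -- the vector that `S^{g+1} - w⁻¹` maps to `(A - z) E`
  set y : EllTwo := v (Fin.last g) • ∑ l : Fin (g + 1), (p l : ℂ) • e (l : ℕ)
    - (w * β) • (blockShift g).symm (e (Fin.last g : ℕ)) with hy
  have hAE : A E - z • E = blockShift g y - w⁻¹ • y := by
    have hAE' : A E = ∑ l : Fin (g + 1), ((((Fin.snoc C 0 : Fin (g + 1) → ℝ) l : ℝ) : ℂ) * v l +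
        ∑ m, ((if l < m then q l * p m else p l * q m : ℝ) : ℂ) * v m) • e (l : ℕ)
        + β • (blockShift g).symm (e (Fin.last g : ℕ))
        + v (Fin.last g) • blockShift g (∑ l : Fin (g + 1), (p l : ℂ) • e (l : ℕ)) := by
      have hif : v (Fin.last g) • blockShift g (∑ l : Fin (g + 1), (p l : ℂ) • e (l : ℕ))
          = ∑ m, v m • if m = Fin.last g then
            blockShift g (∑ l : Fin (g + 1), (p l : ℂ) • e (l : ℕ)) else 0 := by
        simp
      rw [hE, map_sum, hif, hβ, Finset.sum_smul]
      simp only [map_smul, h.apply_e, smul_add, Finset.sum_add_distrib, add_smul, Finset.sum_smul,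
        Finset.smul_sum, smul_smul]
      rw [Finset.sum_comm (f := fun x y => (v x * _) • _)]
      simp only [mul_comm (v _)]
      abel
    have hcoef (l : Fin (g + 1)) : ((Fin.snoc C 0 : Fin (g + 1) → ℝ) l : ℂ) * v l +
        ∑ m, ((if l < m then q l * p m else p l * q m : ℝ) : ℂ) * v m
        = z * v l - p l * (w⁻¹ * v (Fin.last g)) - if l = Fin.last g then w * β else 0 := by
      have h1 := hv l
      have hs : (Fin.snoc (fun k => (C k : ℂ)) 0 : Fin (g + 1) → ℂ) l
          = ((Fin.snoc C 0 : Fin (g + 1) → ℝ) l : ℂ) := by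
        refine Fin.lastCases ?_ (fun k => ?_) l <;> simp
      have hsum : ∑ m, (if m < l then (q m : ℂ) * p l else p m * q l) • v m
          = ∑ m, ((if l < m then q l * p m else p l * q m : ℝ) : ℂ) * v m := by
        refine Finset.sum_congr rfl fun m _ => ?_
        rw [smul_eq_mul]
        congr 1
        rcases lt_trichotomy l m with hl | rfl | hl
        · simp [hl, hl.not_gt, mul_comm]
        · simp
        · simp [hl, hl.not_gt, mul_comm]
      rw [hs, hsum] at h1
      have hsymm (a : ℂ) : (LinearEquiv.smulOfNeZero ℂ ℂ w hw0).symm a = w⁻¹ * a := by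
        rw [LinearEquiv.symm_apply_eq]
        simp [hw0]
      rw [hsymm] at h1
      simp only [LinearEquiv.smulOfNeZero_apply, smul_eq_mul, ← hβ] at h1
      linear_combination -h1
    have hlast : ∑ l : Fin (g + 1), (if l = Fin.last g then w * β else 0) • e (l : ℕ)
        = (w * β) • e (Fin.last g : ℕ) := by
      simp
    have hp' : ∑ l : Fin (g + 1), ((p l : ℂ) * (w⁻¹ * v (Fin.last g))) • e (l : ℕ)
        = (w⁻¹ * v (Fin.last g)) • ∑ l : Fin (g + 1), (p l : ℂ) • e (l : ℕ) := by
      simp only [Finset.smul_sum, smul_smul, mul_comm]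
    have hz' : ∑ l : Fin (g + 1), (z * v l) • e (l : ℕ) = z • E := by
      simp only [hE, Finset.smul_sum, smul_smul]
    rw [hAE']
    simp only [hcoef, sub_smul, Finset.sum_sub_distrib]
    rw [hlast, hp', hz', hy, map_sub, map_smul, map_smul, LinearIsometryEquiv.apply_symm_apply,
      smul_sub, smul_smul, smul_smul, ← mul_assoc, inv_mul_cancel₀ hw0, one_mul]
    abel
  rw [spectrum.mem_iff]
  intro hunit
  obtain ⟨U, hU⟩ := hunit
  set R : EllTwo →L[ℂ] EllTwo := ↑U⁻¹ with hR
  have hUf (f : EllTwo) : (U : EllTwo →L[ℂ] EllTwo) f = z • f - A f := by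
    rw [hU]; simp [Algebra.algebraMap_eq_smul_one]
  have hRU (f : EllTwo) : R (z • f - A f) = f := by
    rw [← hUf]
    exact congrArg (fun S : EllTwo →L[ℂ] EllTwo => S f) U.inv_mul
  have hUR (f : EllTwo) : z • R f - A (R f) = f := by
    rw [← hUf]
    exact congrArg (fun S : EllTwo →L[ℂ] EllTwo => S f) U.mul_inv
  refine hv0 (eq_zero_of_blockShift_sub (f := -R y) hw ?_)
  rw [← hE, ← hRU E, ← hRU (blockShift g (-R y) - w⁻¹ • -R y)]
  congr 1
  have h3 : z • E - A E = -(blockShift g y - w⁻¹ • y) := by rw [← hAE]; abel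
  have h4 := hUR y
  rw [h3]
  conv_lhs => rw [← h4]
  simp only [map_sub, map_smul, map_neg, h.blockShift_apply]
  module

theorem IsGMP.spectrum_eq (hA : IsGMP C A) (h : IsPeriodicWith C p q A) :
    spectrum ℂ A = {z : ℂ | (∀ k, z ≠ (C k : ℂ)) ∧
      ∃ x : ℝ, x ∈ Set.Icc (-2 : ℝ) 2 ∧ discriminant C p q z = (x : ℂ)} := by
  ext z
  exact ⟨(hA.isPeriodicOperator h).exists_discriminant_eq_of_mem_spectrum,
    fun ⟨h1, x, hx, hd⟩ => mem_spectrum_of_discriminant h (h.last_pos 0) h1 hx hd⟩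

end Spectrum

/-! ### Spectral measures -/

section StrongConvergence

variable {H : Type*} [NormedAddCommGroup H] [InnerProductSpace ℂ H]

/-- A sequence of contractions that tends to zero on a spanning family tends to zero strongly. -/
theorem tendsto_apply_zero_of_dense {ι : Type*} {b : ι → H}
    (hb : (Submodule.span ℂ (Set.range b)).topologicalClosure = ⊤) {R : ℕ → H →L[ℂ] H}
    (hR : ∀ n, ‖R n‖ ≤ 1) (h : ∀ i, Filter.Tendsto (fun n => R n (b i)) Filter.atTop (nhds 0))
    (f : H) : Filter.Tendsto (fun n => R n f) Filter.atTop (nhds 0) := by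
  have hspan : ∀ f ∈ Submodule.span ℂ (Set.range b),
      Filter.Tendsto (fun n => R n f) Filter.atTop (nhds 0) := by
    intro f hf
    induction hf using Submodule.span_induction with
    | mem x hx => obtain ⟨i, rfl⟩ := hx; exact h i
    | zero => simp
    | add x y _ _ hx hy => simpa using hx.add hy
    | smul c x _ hx => simpa using hx.const_smul c
  have hd := Submodule.dense_iff_topologicalClosure_eq_top.2 hb
  rw [Metric.tendsto_atTop]
  intro ε hε
  obtain ⟨y, hy, hfy⟩ := Metric.mem_closure_iff.1 (hd f) (ε / 2) (by linarith)
  obtain ⟨N, hN⟩ := Metric.tendsto_atTop.1 (hspan y hy) (ε / 2) (by linarith)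
  refine ⟨N, fun n hn => ?_⟩
  have h1 := hN n hn
  rw [dist_zero_right] at h1 ⊢
  have h2 : ‖R n (f - y)‖ ≤ ‖f - y‖ :=
    ((R n).le_opNorm _).trans (mul_le_of_le_one_left (norm_nonneg _) (hR n))
  have h3 : R n f = R n (f - y) + R n y := by simp
  rw [dist_eq_norm] at hfy
  rw [h3]
  linarith [norm_add_le (R n (f - y)) (R n y)]

end StrongConvergence

section SpectralMeasure

variable {H : Type*} [NormedAddCommGroup H] [InnerProductSpace ℂ H] [CompleteSpace H]

instance regular_spectralMeasure (A : H →L[ℂ] H) (f : H) : (spectralMeasure A f).Regular :=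
  RealRMK.regular_rieszMeasure _

theorem spectralMeasure_le (A : H →L[ℂ] H) (f : H) {k : ℝ → ℝ} (hk : Continuous k)
    (hc : HasCompactSupport k) (h0 : ∀ x, 0 ≤ k x) {K : Set ℝ} (hK : IsCompact K)
    (h1 : ∀ x ∈ K, k x = 1) :
    spectralMeasure A f K ≤ ENNReal.ofReal (RCLike.re ⟪f, cfc k A f⟫_ℂ) :=
  RealRMK.rieszMeasure_le_of_eq_one (spectralFunctional A f) (f := ⟨⟨k, hk⟩, hc⟩) h0 hK h1

/-- Spectral measures live on the spectrum. -/
theorem spectralMeasure_compl_spectrum (A : H →L[ℂ] H) (f : H) :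
    spectralMeasure A f (spectrum ℝ A)ᶜ = 0 := by
  rw [(spectrum.isClosed A).isOpen_compl.measure_eq_iSup_isCompact]
  simp only [ENNReal.iSup_eq_zero]
  intro K hKs hK
  obtain ⟨k, hk1, hk0, hkc, hk⟩ := exists_continuous_one_zero_of_isCompact hK (spectrum.isClosed A)
    (Set.disjoint_left.2 hKs)
  have h := spectralMeasure_le A f k.continuous hkc (fun x => (hk x).1) hK hk1
  rw [cfc_congr (g := 0) hk0, cfc_zero] at h
  simpa using h

/-- A function on the spectrum that is nonnegative and equal to one on `K` bounds the spectral
measure of `K`: it extends to a nonnegative compactly supported function. -/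
theorem spectralMeasure_le_of_continuousOn_spectrum (A : H →L[ℂ] H) (f : H) {k : ℝ → ℝ}
    (hk : ContinuousOn k (spectrum ℝ A)) (h0 : ∀ x ∈ spectrum ℝ A, 0 ≤ k x) {K : Set ℝ}
    (hK : IsCompact K) (hKs : K ⊆ spectrum ℝ A) (h1 : ∀ x ∈ K, k x = 1) :
    spectralMeasure A f K ≤ ENNReal.ofReal (RCLike.re ⟪f, cfc k A f⟫_ℂ) := by
  obtain ⟨G, hG⟩ := ContinuousMap.exists_restrict_eq (spectrum.isClosed A)
    (⟨_, continuousOn_iff_continuous_domRestrict.1 hk⟩ : C(spectrum ℝ A, ℝ))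
  have hGk {x : ℝ} (hx : x ∈ spectrum ℝ A) : G x = k x :=
    congrArg (fun F : C(spectrum ℝ A, ℝ) => F ⟨x, hx⟩) hG
  obtain ⟨χ, hχ1, -, hχc, hχ⟩ := exists_continuous_one_zero_of_isCompact (spectrum.isCompact A)
    (isClosed_empty (X := ℝ)) (Set.disjoint_empty _)
  have hs : (spectrum ℝ A).EqOn k fun x => χ x * |G x| := fun x hx => by
    simp only [hχ1 hx, hGk hx, abs_of_nonneg (h0 x hx), Pi.one_apply, one_mul]
  rw [cfc_congr hs]
  exact spectralMeasure_le A f (by fun_prop) hχc.mul_right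
    (fun x => mul_nonneg (hχ x).1 (abs_nonneg _)) hK fun x hx => (hs (hKs hx)).symm.trans (h1 x hx)

/-- If all vectors are absolutely continuous, `acSpectrum` asks for bijectivity of `A - z` on the
whole space. -/
theorem acSpectrum_eq_spectrum {A : H →L[ℂ] H} (hA : ∀ f : H, spectralMeasure A f ≪ volume) :
    acSpectrum A = spectrum ℂ A := by
  have hac : acVectors A = Set.univ := Set.eq_univ_of_forall hA
  ext z
  rw [acSpectrum, Set.mem_ofPred_eq, hac, Set.bijOn_univ, spectrum.mem_iff, ← IsUnit.neg_iff,
    neg_sub, ContinuousLinearMap.isUnit_iff_bijective]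
  have : ⇑(A - algebraMap ℂ (H →L[ℂ] H) z) = fun f => A f - z • f := by
    funext f
    simp [Algebra.algebraMap_eq_smul_one]
  rw [this]

end SpectralMeasure

/-! ### Chebyshev moments and the arcsine distribution -/

section Chebyshev

open Polynomial.Chebyshev

/-- The Chebyshev polynomials span all polynomials, because their span is stable under
multiplication by `X`. -/
theorem span_range_chebyshevT :
    Submodule.span ℝ (Set.range fun k : ℤ => Polynomial.Chebyshev.T ℝ k) = ⊤ := by
  set S := Submodule.span ℝ (Set.range fun k : ℤ => Polynomial.Chebyshev.T ℝ k) with hS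
  have hT (k : ℤ) : Polynomial.Chebyshev.T ℝ k ∈ S := Submodule.subset_span ⟨k, rfl⟩
  have hX : ∀ P ∈ S, Polynomial.X * P ∈ S := by
    intro P hP
    induction hP using Submodule.span_induction with
    | mem x hx =>
      obtain ⟨k, rfl⟩ := hx
      have : Polynomial.X * Polynomial.Chebyshev.T ℝ k = (1 / 2 : ℝ) •
          (Polynomial.Chebyshev.T ℝ (k + 1) + Polynomial.Chebyshev.T ℝ (k - 1)) := by
        rw [Polynomial.Chebyshev.T_add_one, sub_add_cancel, mul_assoc, two_mul, ← two_smul ℝ,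
          smul_smul]
        simp
      simp only [this]
      exact S.smul_mem _ (S.add_mem (hT _) (hT _))
    | zero => simp
    | add x y _ _ hx hy => rw [mul_add]; exact S.add_mem hx hy
    | smul c x _ hx => rw [mul_smul_comm]; exact S.smul_mem _ hx
  rw [eq_top_iff]
  rintro P -
  induction P using Polynomial.induction_on' with
  | add P Q hP hQ => exact S.add_mem hP hQ
  | monomial n a =>
    rw [← Polynomial.smul_X_eq_monomial]
    refine S.smul_mem _ ?_
    induction n with
    | zero => simpa using hT 0
    | succ n ih => rw [pow_succ']; exact hX _ ih

theorem measureT_absolutelyContinuous : measureT ≪ volume :=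
  Measure.restrict_le_self.absolutelyContinuous.trans (withDensity_absolutelyContinuous _ _)

instance isFiniteMeasure_measureT : IsFiniteMeasure measureT := by
  have h : Integrable (fun _ : ℝ => (1 : ℝ)) measureT := integrable_measureT continuousOn_const
  exact (integrable_const_iff_isFiniteMeasure one_ne_zero).1 h

theorem abs_integral_measureT_le {φ : ℝ → ℝ} {ε : ℝ}
    (h : ∀ x ∈ Set.Icc (-1 : ℝ) 1, |φ x| ≤ ε) : |∫ x, φ x ∂measureT| ≤ ε * Real.pi := by
  rw [integral_measureT_eq_integral_cos]
  have := intervalIntegral.norm_integral_le_of_norm_le_const (a := 0) (b := Real.pi) (C := ε)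
    (f := fun θ => φ (Real.cos θ)) fun θ _ => h _ ⟨Real.neg_one_le_cos θ, Real.cos_le_one θ⟩
  simpa [abs_of_pos Real.pi_pos] using this

variable {H : Type*} [NormedAddCommGroup H] [InnerProductSpace ℂ H]
  {g : ℕ} {b : ℤ × Fin (g + 1) → H} {Y : H →L[ℂ] H}

/-- If `Y` acts on a basis as half the sum of the translations in both directions, its Chebyshev
polynomials act in the same way, with longer translations. -/
theorem aeval_chebyshevT_apply
    (hY : ∀ j l, Y (b (j, l)) = (1 / 2 : ℂ) • (b (j + 1, l) + b (j - 1, l))) (k j : ℤ)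
    (l : Fin (g + 1)) : Polynomial.aeval Y (Polynomial.Chebyshev.T ℝ k) (b (j, l))
      = (1 / 2 : ℂ) • (b (j + k, l) + b (j - k, l)) := by
  have hnat (n : ℕ) : ∀ j, Polynomial.aeval Y (Polynomial.Chebyshev.T ℝ n) (b (j, l))
      = (1 / 2 : ℂ) • (b (j + n, l) + b (j - n, l)) := by
    induction n using Nat.twoStepInduction with
    | zero => intro j; simp [← two_smul ℂ, smul_smul]
    | one => intro j; simpa using hY j l
    | more n ih1 ih2 =>
      intro j
      have h2 : Polynomial.Chebyshev.T ℝ ((n + 2 : ℕ) : ℤ)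
          = (2 : ℝ) • (Polynomial.X * Polynomial.Chebyshev.T ℝ ((n + 1 : ℕ) : ℤ))
            - Polynomial.Chebyshev.T ℝ (n : ℤ) := by
        push_cast
        rw [Polynomial.Chebyshev.T_add_two, mul_assoc, Polynomial.smul_eq_C_mul]
        rfl
      rw [h2, map_sub, map_smul, map_mul, Polynomial.aeval_X]
      change (2 : ℝ) • Y (Polynomial.aeval Y (Polynomial.Chebyshev.T ℝ ((n + 1 : ℕ) : ℤ))
        (b (j, l))) - Polynomial.aeval Y (Polynomial.Chebyshev.T ℝ (n : ℤ)) (b (j, l)) = _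
      rw [ih1, ih2, map_smul, map_add, hY, hY, ← Complex.coe_smul]
      push_cast
      rw [show j + ((n : ℤ) + 1) - 1 = j + n by ring, show j - ((n : ℤ) + 1) + 1 = j - n by ring,
        show j + ((n : ℤ) + 1) + 1 = j + (n + 2) by ring,
        show j - ((n : ℤ) + 1) - 1 = j - (n + 2) by ring]
      module
  obtain ⟨n, rfl | rfl⟩ := k.eq_nat_or_neg
  · exact hnat n j
  · rw [Polynomial.Chebyshev.T_neg, hnat, sub_neg_eq_add, add_comm (b _), ← sub_eq_add_neg]

/-- The moments of `Y` at a basis vector are those of the arcsine distribution. Both sides are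
linear in the polynomial and agree on the Chebyshev polynomials. -/
theorem re_inner_aeval_basis (hb : Orthonormal ℂ b)
    (hY : ∀ j l, Y (b (j, l)) = (1 / 2 : ℂ) • (b (j + 1, l) + b (j - 1, l)))
    (P : Polynomial ℝ) (i : ℤ × Fin (g + 1)) :
    RCLike.re ⟪b i, Polynomial.aeval Y P (b i)⟫_ℂ = Real.pi⁻¹ * ∫ x, P.eval x ∂measureT := by
  obtain ⟨j, l⟩ := i
  have hint (P : Polynomial ℝ) : Integrable (fun x => P.eval x) measureT :=
    integrable_measureT P.continuous.continuousOn
  have hP : P ∈ Submodule.span ℝ (Set.range fun k : ℤ => Polynomial.Chebyshev.T ℝ k) := by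
    rw [span_range_chebyshevT]; trivial
  induction hP using Submodule.span_induction with
  | mem x hx =>
    obtain ⟨k, rfl⟩ := hx
    simp only [aeval_chebyshevT_apply hY]
    rw [inner_smul_right, inner_add_right, orthonormal_iff_ite.1 hb, orthonormal_iff_ite.1 hb]
    rcases eq_or_ne k 0 with rfl | hk
    · rw [integral_eval_T_real_measureT_zero, inv_mul_cancel₀ Real.pi_ne_zero]
      norm_num
    · rw [integral_eval_T_real_measureT_of_ne_zero hk]
      have h1 : j ≠ j - k := by omega
      simp [hk, h1]
  | zero => simp
  | add P Q _ _ hP hQ =>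
    simp only [map_add, add_apply, inner_add_right, Polynomial.eval_add]
    rw [integral_add (hint P) (hint Q), hP, hQ, mul_add]
  | smul c P _ hP =>
    have : RCLike.re ⟪b (j, l), c • (Polynomial.aeval Y P (b (j, l)))⟫_ℂ
        = c * RCLike.re ⟪b (j, l), Polynomial.aeval Y P (b (j, l))⟫_ℂ := by
      rw [← Complex.coe_smul, inner_smul_right]
      simp
    simp only [map_smul, smul_apply, Polynomial.eval_smul, smul_eq_mul]
    rw [integral_const_mul, this, hP]
    ring

variable [CompleteSpace H]

/-- The spectral measure of `Y` at a basis vector is the arcsine distribution. -/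
theorem re_inner_cfc_basis (hb : Orthonormal ℂ b) (hYsa : IsSelfAdjoint Y)
    (hYs : spectrum ℝ Y ⊆ Set.Icc (-1) 1)
    (hY : ∀ j l, Y (b (j, l)) = (1 / 2 : ℂ) • (b (j + 1, l) + b (j - 1, l)))
    {φ : ℝ → ℝ} (hφ : Continuous φ) (i : ℤ × Fin (g + 1)) :
    RCLike.re ⟪b i, cfc φ Y (b i)⟫_ℂ = Real.pi⁻¹ * ∫ x, φ x ∂measureT := by
  refine eq_of_forall_dist_le fun ε hε => ?_
  rw [Real.dist_eq]
  obtain ⟨P, hP⟩ := exists_polynomial_near_of_continuousOn (-1) 1 φ hφ.continuousOn (ε / 2)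
    (by linarith)
  have h1 : |RCLike.re ⟪b i, cfc φ Y (b i)⟫_ℂ - RCLike.re ⟪b i, Polynomial.aeval Y P (b i)⟫_ℂ|
      ≤ ε / 2 := by
    rw [← map_sub, ← inner_sub_right, ← cfc_polynomial P Y hYsa,
      ← sub_apply,
      ← cfc_sub φ P.eval Y hφ.continuousOn P.continuous.continuousOn]
    refine (RCLike.abs_re_le_norm _).trans ((norm_inner_le_norm _ _).trans ?_)
    rw [hb.1 i, one_mul]
    refine (ContinuousLinearMap.le_opNorm _ _).trans ?_
    rw [hb.1 i, mul_one]
    refine norm_cfc_le (by linarith) fun x hx => ?_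
    rw [Real.norm_eq_abs, abs_sub_comm]
    exact (hP x (hYs hx)).le
  have h2 : |(∫ x, P.eval x ∂measureT) - ∫ x, φ x ∂measureT| ≤ ε / 2 * Real.pi := by
    rw [← integral_sub (integrable_measureT P.continuous.continuousOn)
      (integrable_measureT hφ.continuousOn)]
    exact abs_integral_measureT_le fun x hx => (hP x hx).le
  have h3 : |RCLike.re ⟪b i, Polynomial.aeval Y P (b i)⟫_ℂ - Real.pi⁻¹ * ∫ x, φ x ∂measureT|
      ≤ ε / 2 := by
    rw [re_inner_aeval_basis hb hY, ← mul_sub, abs_mul, abs_of_pos (inv_pos.2 Real.pi_pos)]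
    calc Real.pi⁻¹ * _ ≤ Real.pi⁻¹ * (ε / 2 * Real.pi) := by
          gcongr
      _ = ε / 2 := by field_simp
  linarith [abs_sub_le (RCLike.re ⟪b i, cfc φ Y (b i)⟫_ℂ)
    (RCLike.re ⟪b i, Polynomial.aeval Y P (b i)⟫_ℂ) (Real.pi⁻¹ * ∫ x, φ x ∂measureT)]

/-- Cutoff functions that shrink to a closed null set are turned by the functional calculus of `Y`
into operators that tend to zero strongly. -/
theorem tendsto_cfc_thickenedIndicator (hb : Orthonormal ℂ b)
    (hd : (Submodule.span ℂ (Set.range b)).topologicalClosure = ⊤) (hYsa : IsSelfAdjoint Y)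
    (hYs : spectrum ℝ Y ⊆ Set.Icc (-1) 1)
    (hY : ∀ j l, Y (b (j, l)) = (1 / 2 : ℂ) • (b (j + 1, l) + b (j - 1, l)))
    {Z : Set ℝ} (hZ : IsClosed Z) (hZ0 : volume Z = 0) {δ : ℕ → ℝ} (hδ : ∀ n, 0 < δ n)
    (hδ0 : Filter.Tendsto δ Filter.atTop (nhds 0)) (f : H) :
    Filter.Tendsto (fun n => cfc (fun x => (thickenedIndicator (hδ n) Z x : ℝ)) Y f)
      Filter.atTop (nhds 0) := by
  have hcont (n : ℕ) : Continuous fun x => (thickenedIndicator (hδ n) Z x : ℝ) := by fun_prop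
  have hle (n : ℕ) (x : ℝ) : (thickenedIndicator (hδ n) Z x : ℝ) ≤ 1 :=
    thickenedIndicator_le_one (hδ n) Z x
  refine tendsto_apply_zero_of_dense hd (fun n => norm_cfc_le zero_le_one fun x _ => ?_)
    (fun i => ?_) f
  · rw [Real.norm_of_nonneg (NNReal.coe_nonneg _)]
    exact hle n x
  · have ht := tendsto_integral_thickenedIndicator_of_isClosed measureT hZ hδ hδ0
    rw [Measure.real, measureT_absolutelyContinuous hZ0, ENNReal.toReal_zero] at ht
    have hsq (n : ℕ) : ‖cfc (fun x => (thickenedIndicator (hδ n) Z x : ℝ)) Y (b i)‖ ^ 2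
        ≤ Real.pi⁻¹ * ∫ x, (thickenedIndicator (hδ n) Z x : ℝ) ∂measureT := by
      set h : ℝ → ℝ := fun x => (thickenedIndicator (hδ n) Z x : ℝ) with hh
      have hsa : IsSelfAdjoint (cfc h Y) := cfc_predicate h Y
      have h1 : ‖cfc h Y (b i)‖ ^ 2 = RCLike.re ⟪b i, cfc (fun x => h x * h x) Y (b i)⟫_ℂ := by
        rw [cfc_mul h h Y (hcont n).continuousOn (hcont n).continuousOn,
          mul_apply_eq_comp, ← ContinuousLinearMap.adjoint_inner_left,
          ← ContinuousLinearMap.star_eq_adjoint, hsa.star_eq]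
        exact (inner_self_eq_norm_sq (𝕜 := ℂ) _).symm
      rw [h1, re_inner_cfc_basis hb hYsa hYs hY (φ := fun x => h x * h x)
        ((hcont n).mul (hcont n))]
      refine mul_le_mul_of_nonneg_left ?_ (inv_pos.2 Real.pi_pos).le
      refine integral_mono (integrable_measureT ((hcont n).mul (hcont n)).continuousOn)
        (integrable_measureT (hcont n).continuousOn) fun x => ?_
      exact mul_le_of_le_one_left (NNReal.coe_nonneg _) (hle n x)
    have h0 := squeeze_zero (fun n => sq_nonneg _) hsq (by simpa using ht.const_mul Real.pi⁻¹)
    rw [tendsto_zero_iff_norm_tendsto_zero]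
    simpa using h0.sqrt

end Chebyshev

/-! ### Absolute continuity of the spectrum -/

section AbsolutelyContinuous

variable {H : Type*} [NormedAddCommGroup H] [InnerProductSpace ℂ H] [CompleteSpace H]
  {g : ℕ} {C : Fin g → ℝ} {p q : Fin (g + 1) → ℝ} {A : H →L[ℂ] H} {T : H ≃ₗᵢ[ℂ] H}
  {b : ℤ × Fin (g + 1) → H}

/-- A compact null set `K` in the spectrum is mapped by the discriminant to a null set, and cutoffs
of the latter, composed with the discriminant, bound the spectral measure of `K`. -/
theorem IsPeriodicOperator.spectralMeasure_eq_zero (h : IsPeriodicOperator C p q A T b) (f : H)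
    {K : Set ℝ} (hK : IsCompact K) (hKs : K ⊆ spectrum ℝ A) (hK0 : volume K = 0) :
    spectralMeasure A f K = 0 := by
  have hA := h.isSelfAdjoint
  -- halved, so that its values lie in the interval `[-1, 1]` of the Chebyshev polynomials
  set D : ℝ → ℝ := fun x => (1 / 2 : ℝ) * realDiscriminant C p q x with hD
  have hDc : ContinuousOn D (spectrum ℝ A) := continuousOn_const.mul h.continuousOn_realDiscriminant
  set Y := cfc D A with hYdef
  have hYsa : IsSelfAdjoint Y := cfc_predicate D A
  have hYs : spectrum ℝ Y ⊆ Set.Icc (-1) 1 := by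
    rw [hYdef, cfc_map_spectrum D A hA hDc]
    rintro _ ⟨x, hx, rfl⟩
    have := h.realDiscriminant_mem_Icc hx
    simp only [hD]
    constructor <;> linarith [this.1, this.2]
  have hY (j : ℤ) (l : Fin (g + 1)) :
      Y (b (j, l)) = (1 / 2 : ℂ) • (b (j + 1, l) + b (j - 1, l)) := by
    have hs : T.symm (b (j, l)) = b (j - 1, l) := by
      rw [LinearIsometryEquiv.symm_apply_eq, h.shift_apply, sub_add_cancel]
    rw [hYdef, hD, cfc_const_mul _ _ _ h.continuousOn_realDiscriminant, h.cfc_realDiscriminant,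
      ← h.shift_apply, ← hs, smul_apply, ← Complex.coe_smul]
    push_cast
    rfl
  set Z : Set ℝ := D '' K with hZdef
  have hZ : IsCompact Z := hK.image_of_continuousOn (hDc.mono hKs)
  have hZ0 : volume Z = 0 :=
    addHaar_image_eq_zero_of_differentiableOn_of_addHaar_eq_zero _ (fun x hx =>
      ((differentiableAt_realDiscriminant C p q
        (h.ne_of_mem_spectrum (hKs hx))).const_mul _).differentiableWithinAt) hK0
  have hδ (n : ℕ) : (0 : ℝ) < 1 / ((n : ℝ) + 1) := by positivity
  have ht := tendsto_cfc_thickenedIndicator h.orthonormal h.dense hYsa hYs hY hZ.isClosed hZ0 hδ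
    tendsto_one_div_add_atTop_nhds_zero_nat f
  have hb (n : ℕ) : spectralMeasure A f K ≤ ENNReal.ofReal (RCLike.re
      ⟪f, cfc (fun x => (thickenedIndicator (hδ n) Z x : ℝ)) Y f⟫_ℂ) := by
    have hc : Continuous fun x => (thickenedIndicator (hδ n) Z x : ℝ) := by fun_prop
    rw [hYdef, ← cfc_comp _ D A hA hc.continuousOn hDc]
    refine spectralMeasure_le_of_continuousOn_spectrum A f (hc.comp_continuousOn hDc)
      (fun x _ => NNReal.coe_nonneg _) hK hKs fun x hx => ?_
    have := thickenedIndicator_one (hδ n) Z (Set.mem_image_of_mem D hx)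
    exact congrArg NNReal.toReal this
  have hlim : Filter.Tendsto (fun n => ENNReal.ofReal (RCLike.re
      ⟪f, cfc (fun x => (thickenedIndicator (hδ n) Z x : ℝ)) Y f⟫_ℂ)) Filter.atTop (nhds 0) := by
    have h1 := (tendsto_const_nhds (x := f)).inner (𝕜 := ℂ) ht
    have h2 := (RCLike.continuous_re.tendsto _).comp h1
    have h3 := ENNReal.tendsto_ofReal h2
    simpa using h3
  exact le_antisymm (ge_of_tendsto' hlim hb) zero_le

theorem IsPeriodicOperator.spectralMeasure_absolutelyContinuous
    (h : IsPeriodicOperator C p q A T b) (f : H) : spectralMeasure A f ≪ volume := by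
  refine Measure.AbsolutelyContinuous.mk fun s hs hs0 => ?_
  rw [hs.measure_eq_iSup_isCompact]
  simp only [ENNReal.iSup_eq_zero]
  intro K hKs hK
  have h1 := h.spectralMeasure_eq_zero f (hK.inter_right (spectrum.isClosed A))
    Set.inter_subset_right (measure_mono_null (Set.inter_subset_left.trans hKs) hs0)
  refine measure_mono_null (t := K ∩ spectrum ℝ A ∪ (spectrum ℝ A)ᶜ) (fun x hx => ?_)
    (measure_union_null h1 (spectralMeasure_compl_spectrum A f))
  by_cases hxs : x ∈ spectrum ℝ A
  · exact Or.inl ⟨hx, hxs⟩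
  · exact Or.inr hxs

end AbsolutelyContinuous

end GMP

end

theorem theorem3 {g : ℕ} (C : Fin g → ℝ) (hC : Function.Injective C)
    (A : GMP.EllTwo →L[ℂ] GMP.EllTwo) (hA : GMP.IsGMP C A)
    (p q : Fin (g + 1) → ℝ) (hpq : GMP.IsPeriodicWith C p q A) :
    GMP.HasPurelyACSpectrum A ∧
      spectrum ℂ A = GMP.acSpectrum A ∧
      GMP.acSpectrum A =
        {z : ℂ | (∀ k, z ≠ (C k : ℂ)) ∧
          ∃ x : ℝ, x ∈ Set.Icc (-2 : ℝ) 2 ∧ GMP.discriminant C p q z = (x : ℂ)} := by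
  have hac := (hA.isPeriodicOperator hpq).spectralMeasure_absolutelyContinuous
  have hsp := GMP.acSpectrum_eq_spectrum hac
  exact ⟨⟨hpq.isSelfAdjoint, hac⟩, hsp.symm, hsp.trans (hA.spectrum_eq hpq)⟩
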